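/- **Setting.** An environment $\nu$ with $m\ge 1$ change points consists of a function $f:[0,1]\to\mathbb R$, $f(x)=\mu_0+\sum_{i=1}^m\Delta_i\mathbf 1_{x\ge x_i^*}$, with $0<x_1^*<\dots<x_m^*<1$ and $0<|\Delta_i|\le 1$, and of a law on $\mathbb R$ of i.i.d. noise variables $\varepsilon_t$ that are centred and 1-sub-Gaussian ($\mathbb E[\varepsilon_t]=0$ and $\mathbb E[e^{\lambda\varepsilon_t}]\le e^{\lambda^2/2}$ for all $\lambda\in\mathbb R$). Put $\vartheta_i=x_{i+1}^*-x_i^*$ for $1\le i\le m-1$, $\vartheta_0=\vartheta_m=1$, $s_i=\min(\vartheta_{i-1},\vartheta_i)$ for $1\le i\le m$, and $$H_{\mathrm{detect}}^{(m,\nu)}=\max_{1\le i\le m}\frac1{s_i\Delta_i^2},\qquad H_{\mathrm{localize}}^{(m,\nu)}=\sum_{i=1}^m\frac1{\Delta_i^2}.$$ A (possibly randomized) algorithm $\pi$ chooses at each round $t$, from its past observations, a query $x_t\in[0,1]$, observes $y_t=f(x_t)+\varepsilon_t$, decides when to stop, and, when it stops, returns $N$ real estimates $\hat x_1,\dots,\hat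 x_N$. Its budget $\mathcal T_\pi\in\mathbb N\cup\{\infty\}$ is the number of queries made before it stops. It is $(\delta,\eta,N)$-correct if, for every environment $\nu$ with $m'\ge N$ change points, with probability at least $1-\delta$ under $\nu$ it stops and there are $1\le i_1<\dots<i_N\le m'$ with $|\hat x_l-x_{i_l}^*|\le\eta$ for all $l\in\{1,\dots,N\}$. Write $\log_+(x)=\max(\log x,0)$. **Statement.** There is a numerical constant $c>0$ such that the following holds. Let $\delta\in(0,1/16)$, $\eta\in(0,1/8)$ and $m\ge1$. Let $\nu$ be an environment with $m$ change points such that $\vartheta_i>2\eta$ for all $i=2,\dots,m-1$ (in particular, any environment whose change points are all more than $2\eta$ apart), and let $\pi$ be a $(\delta,\eta,m)$-correct algorithm. Then there exists an environment $\nu'$ with $m$ change points (which may depend on $\nu$, $\pi$, $\delta$ and $\eta$) such that $$H_{\mathrm{detect}}^{(m,\nu)}\le H_{\mathrm{detect}}^{(m,\nu')}\le 4H_{\mathrm{detect}}^{(m,\nu)},\qquad \tfrac12H_{\mathrm{localize}}^{(m,\nu)}\le H_{\mathrm{localize}}^{(m,\nu')}\le H_{\mathrm{localize}}^{(m,\nu)},$$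 and $$\mathbb E_{\pi,\nu'}[\mathcal T_\pi]\ \ge\ c\left(H_{\mathrm{detect}}^{(m,\nu)}+H_{\mathrm{localize}}^{(m,\nu)}\log\frac1{4\delta}+\sum_{i=1}^m\frac1{\Delta_i^2}\log_+\!\Big(\frac{s_i}{16\eta}\Big)\right),$$ where $\Delta_i$ and $s_i$ are those of $\nu$. -/

import Mathlib

open MeasureTheory ProbabilityTheory
open scoped ENNReal

/-- An environment with `m` change points: a piecewise constant function on `[0,1]`, given by its
baseline level, the positions `0 < x₁ < ⋯ < x_m < 1` of its discontinuities and its nonzero jumps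
(bounded by one), together with the common law of the i.i.d. centred 1-sub-Gaussian noise.
The `i`-th change point (`1 ≤ i ≤ m`) has index `i - 1` in `Fin m`. -/
structure CPEnvironment (m : ℕ) where
  baseline : ℝ
  pos : Fin m → ℝ
  pos_strictMono : StrictMono pos
  pos_mem : ∀ i, pos i ∈ Set.Ioo (0 : ℝ) 1
  jump : Fin m → ℝ
  jump_ne_zero : ∀ i, jump i ≠ 0
  abs_jump_le_one : ∀ i, |jump i| ≤ 1
  noise : Measure ℝ
  noise_prob : IsProbabilityMeasure noise
  noise_mean : ∫ e, e ∂noise = 0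
  noise_subgaussian : HasSubgaussianMGF (fun e : ℝ => e) 1 noise

attribute [instance] CPEnvironment.noise_prob

namespace CPEnvironment

variable {m : ℕ}

/-- The unknown function `f(x) = μ₀ + ∑ᵢ Δᵢ 1{x ≥ xᵢ}` on `[0,1]`. -/
noncomputable def mean (ν : CPEnvironment m) (x : unitInterval) : ℝ :=
  ν.baseline + ∑ i, if ν.pos i ≤ (x : ℝ) then ν.jump i else 0

/-- The spacings: `ϑᵢ = x_{i+1} - xᵢ` for `1 ≤ i ≤ m - 1` (one-based indices), and
`ϑ₀ = ϑ_m = 1` by convention. Only the indices `0 ≤ i ≤ m` are used. -/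
noncomputable def spacing (ν : CPEnvironment m) (i : ℕ) : ℝ :=
  if h : 1 ≤ i ∧ i < m then ν.pos ⟨i, h.2⟩ - ν.pos ⟨i - 1, by omega⟩ else 1

/-- The local spacing `sᵢ = min(ϑ_{i-1}, ϑᵢ)` of a change point (one-based indices). -/
noncomputable def localSpacing (ν : CPEnvironment m) (i : Fin m) : ℝ :=
  min (ν.spacing i) (ν.spacing (i + 1))

/-- The energy `sᵢ Δᵢ²` of a change point. -/
noncomputable def energySq (ν : CPEnvironment m) (i : Fin m) : ℝ :=
  ν.localSpacing i * ν.jump i ^ 2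

/-- `H_detect`, the maximum over all change points of the inverse energy. -/
noncomputable def detectComplexity (ν : CPEnvironment m) : ℝ :=
  ⨆ i, 1 / ν.energySq i

/-- `H_localize` for `N` change points: the sum of `1 / Δ²` over the `N` jumps that are largest in
absolute value. -/
noncomputable def localizeComplexity (ν : CPEnvironment m) (N : ℕ) : ℝ :=
  ∑ l ∈ Finset.univ.filter (fun l : Fin m => (l : ℕ) < N),
    1 / ν.jump (Tuple.sort (fun i => -|ν.jump i|) l) ^ 2

/-- When all change points are counted, the ordering of the jumps plays no role. -/
theorem localizeComplexity_self (ν : CPEnvironment m) :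
    ν.localizeComplexity m = ∑ i, 1 / ν.jump i ^ 2 := by
  unfold localizeComplexity
  rw [Finset.filter_true_of_mem (fun l _ => l.2)]
  exact Equiv.sum_comp (Tuple.sort (fun i => -|ν.jump i|)) (fun i => 1 / ν.jump i ^ 2)

end CPEnvironment

/-- A randomized sequential algorithm that outputs `N` estimates. All internal randomness is
carried by a random seed, independent of the noise; given the seed, every decision is a
measurable function of the observations made so far (earlier queries are themselves functions
of the seed and of earlier observations). -/
structure CPAlgorithm (N : ℕ) where
  Seed : Type
  seedSpace : MeasurableSpace Seed
  seedLaw : Measure Seed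
  seedLaw_prob : IsProbabilityMeasure seedLaw
  /-- the next query after `t` observations -/
  query : (t : ℕ) → Seed × (Fin t → ℝ) → unitInterval
  measurable_query : ∀ t, Measurable (query t)
  /-- the situations in which the algorithm wants to halt after `t` observations -/
  haltSet : (t : ℕ) → Set (Seed × (Fin t → ℝ))
  measurableSet_haltSet : ∀ t, MeasurableSet (haltSet t)
  /-- the estimates returned when the algorithm halts after `t` observations -/
  estimate : (t : ℕ) → Seed × (Fin t → ℝ) → (Fin N → ℝ)
  measurable_estimate : ∀ t, Measurable (estimate t)

attribute [instance] CPAlgorithm.seedSpace CPAlgorithm.seedLaw_prob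

namespace CPAlgorithm

variable {N m : ℕ}

/-- The sample space of the interaction: the seed and the noise sequence. -/
abbrev Outcome (π : CPAlgorithm N) : Type := π.Seed × (ℕ → ℝ)

/-- The law of the interaction of `π` with `ν`: the seed is independent of the i.i.d. noise. -/
noncomputable def law (π : CPAlgorithm N) (ν : CPEnvironment m) : Measure π.Outcome :=
  π.seedLaw.prod (Measure.infinitePi fun _ : ℕ => ν.noise)

/-- The first `t` observations `y = f(x) + ε`, each query `x` being chosen by the sampling rule
from the seed and the earlier observations. -/
noncomputable def history (π : CPAlgorithm N) (ν : CPEnvironment m) (ω : π.Outcome) :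
    (t : ℕ) → (Fin t → ℝ)
  | 0 => Fin.elim0
  | t + 1 =>
      Fin.snoc (α := fun _ => ℝ) (history π ν ω t)
        (ν.mean (π.query t (ω.1, history π ν ω t)) + ω.2 t)

/-- The number of evaluations made before the algorithm halts (`⊤` if it never halts). -/
noncomputable def budget (π : CPAlgorithm N) (ν : CPEnvironment m) (ω : π.Outcome) : ℕ∞ :=
  ⨅ (t : ℕ) (_ : (ω.1, π.history ν ω t) ∈ π.haltSet t), (t : ℕ∞)

/-- The expected budget, possibly infinite. -/
noncomputable def expectedBudget (π : CPAlgorithm N) (ν : CPEnvironment m) : ℝ≥0∞ :=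
  ∫⁻ ω, (π.budget ν ω : ℝ≥0∞) ∂(π.law ν)

/-- The algorithm halts and its `N` estimates are within `η` of `N` distinct change points,
taken in increasing order. -/
def successEvent (π : CPAlgorithm N) (ν : CPEnvironment m) (η : ℝ) : Set π.Outcome :=
  {ω | ∃ t : ℕ, π.budget ν ω = t ∧ ∃ i : Fin N → Fin m, StrictMono i ∧
    ∀ l, |π.estimate t (ω.1, π.history ν ω t) l - ν.pos (i l)| ≤ η}

/-- `(δ, η, N)`-correctness: success with probability at least `1 - δ` in every environment with
at least `N` change points. -/
def IsCorrect (π : CPAlgorithm N) (δ η : ℝ) : Prop :=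
  ∀ m : ℕ, N ≤ m → ∀ ν : CPEnvironment m,
    ENNReal.ofReal (1 - δ) ≤ π.law ν (π.successEvent ν η)

end CPAlgorithm

/-!
Write `P_g` for the law of the interaction when the unknown function is `g` and the noise is
standard Gaussian. For a pair of functions `g`, `h` and an event `C` that is decided before the
accumulated information `∑ (g - h) ^ 2` along the queries exceeds `K`, the AM-GM inequality
`dP_g / dP_h ≤ (λ + (dP_g / dP_h) ^ 2 / λ) / 2` gives
`P_g(C) ≤ λ / 2 * P_h(C) + exp K / (2 * λ) * P_{2g - h}(C)`, because
`(dP_g / dP_h) ^ 2 dP_h = exp (∑ (g - h) ^ 2) dP_{2g - h}`. Hence a correct algorithm that must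
behave differently under `g` and `h` cannot spend few queries where `g` and `h` differ. Three
choices of perturbations give the three terms of the bound.

* Moving one change point by more than `2 * η` makes the sets of correct answers disjoint, so about
  `log (1 / δ) / Δ ^ 2` queries are needed next to each change point.
* A change point of local spacing `s` may sit at about `s / η` places of its own window, with
  disjoint sets of correct answers; this costs `log (s / η) / Δ ^ 2` queries in that window. The
  windows of distinct change points are disjoint, so averaging over all joint displacements finds
  one environment in which all these costs occur together.
* Two change points can be merged into a bump of width `s` and height `d`, with
  `1 / (s * d ^ 2)` the detection complexity, that is hidden in one of about `1 / s` disjoint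
  windows. Most of these have to be visited about `1 / d ^ 2` times before the bump is found.

The environment `ν'` is chosen according to the largest term.
-/

theorem lintegral_gaussianReal_const_add (c : ℝ) {F : ℝ → ℝ≥0∞} (hF : Measurable F) :
    ∫⁻ e, F (c + e) ∂gaussianReal 0 1
      = ∫⁻ e, F e * ENNReal.ofReal (Real.exp (c * e - c ^ 2 / 2)) ∂gaussianReal 0 1 := by
  have density_eq (e : ℝ) : gaussianPDF c 1 e
      = gaussianPDF 0 1 e * ENNReal.ofReal (Real.exp (c * e - c ^ 2 / 2)) := by
    simp only [gaussianPDF, gaussianPDFReal]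
    rw [← ENNReal.ofReal_mul (by positivity), mul_assoc (_⁻¹), ← Real.exp_add]
    congr 3
    push_cast
    ring
  have map_eq : (gaussianReal 0 1).map (c + ·) = gaussianReal c 1 := by
    rw [gaussianReal_map_const_add, zero_add]
  rw [← lintegral_map hF (measurable_const_add c), map_eq,
    gaussianReal_of_var_ne_zero _ one_ne_zero, gaussianReal_of_var_ne_zero _ one_ne_zero,
    lintegral_withDensity_eq_lintegral_mul _ (measurable_gaussianPDF _ _) hF,
    lintegral_withDensity_eq_lintegral_mul _ (measurable_gaussianPDF _ _) (by fun_prop)]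
  refine lintegral_congr fun e => ?_
  simp only [Pi.mul_apply, density_eq]
  ring

theorem infinitePi_map_update {ι : Type*} [DecidableEq ι] {X : ι → Type*}
    [∀ i, MeasurableSpace (X i)] (μ : ∀ i, Measure (X i)) [∀ i, IsProbabilityMeasure (μ i)]
    (n : ι) :
    ((Measure.infinitePi μ).prod (μ n)).map (fun p => Function.update p.1 n p.2)
      = Measure.infinitePi μ := by
  refine Measure.eq_infinitePi μ fun s t ht => ?_
  have preimage_eq : (fun p : (∀ i, X i) × X n => Function.update p.1 n p.2) ⁻¹' (Set.pi s t)
      = Set.pi (s.erase n : Finset ι) t ×ˢ {e | n ∈ s → e ∈ t n} := by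
    ext p
    simp only [Set.mem_preimage, Set.mem_pi, Set.mem_prod, Finset.mem_coe, Finset.mem_erase,
      Set.mem_ofPred_eq]
    refine ⟨fun h => ⟨fun i hi => by simpa [hi.1] using h i hi.2, fun hn => by simpa using h n hn⟩,
      fun h i hi => ?_⟩
    obtain rfl | hin := eq_or_ne i n
    · simpa using h.2 hi
    · simpa [hin] using h.1 i ⟨hin, hi⟩
  rw [Measure.map_apply (by fun_prop) (.pi s.countable_toSet fun i _ => ht i), preimage_eq,
    Measure.prod_prod, Measure.infinitePi_pi μ fun i _ => ht i]
  by_cases hn : n ∈ s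
  · simpa [hn] using s.prod_erase_mul (fun i => μ i (t i)) hn
  · simp [hn]

namespace CPAlgorithm

variable {N : ℕ} (π : CPAlgorithm N)

/-- The law of the seed and of a sequence of independent standard Gaussian variables. -/
noncomputable def gaussianLaw : Measure π.Outcome :=
  π.seedLaw.prod (Measure.infinitePi fun _ : ℕ => gaussianReal 0 1)

instance : IsProbabilityMeasure π.gaussianLaw := by
  unfold gaussianLaw; infer_instance

/-- The seed and the first `n` terms of the sequence. -/
def trunc (n : ℕ) (ω : π.Outcome) : π.Seed × (Fin n → ℝ) := (ω.1, fun i => ω.2 i)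

@[fun_prop]
theorem measurable_trunc (n : ℕ) : Measurable (π.trunc n) := by
  unfold trunc; fun_prop

variable {π} in
theorem trunc_eq_trunc_iff {n : ℕ} {ω ω' : π.Outcome} :
    π.trunc n ω = π.trunc n ω' ↔ ω.1 = ω'.1 ∧ ∀ t < n, ω.2 t = ω'.2 t := by
  simp only [trunc, Prod.mk.injEq, funext_iff, Fin.forall_iff]

/-- The outcome whose `n`-th term is replaced by `e`. -/
def setTerm (n : ℕ) (ω : π.Outcome) (e : ℝ) : π.Outcome := (ω.1, Function.update ω.2 n e)

@[fun_prop]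
theorem measurable_setTerm {α : Type*} [MeasurableSpace α] (n : ℕ) {f : α → π.Outcome} {e : α → ℝ}
    (hf : Measurable f) (he : Measurable e) : Measurable fun x => π.setTerm n (f x) (e x) := by
  unfold setTerm; fun_prop

theorem trunc_setTerm {k n : ℕ} (h : k ≤ n) (ω : π.Outcome) (e : ℝ) :
    π.trunc k (π.setTerm n ω e) = π.trunc k ω :=
  trunc_eq_trunc_iff.2 ⟨rfl, fun _ ht => Function.update_of_ne (ht.trans_le h).ne _ _⟩

theorem lintegral_gaussianLaw_eq_lintegral_setTerm (n : ℕ) {F : π.Outcome → ℝ≥0∞}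
    (hF : Measurable F) :
    ∫⁻ ω, F ω ∂π.gaussianLaw
      = ∫⁻ ω, ∫⁻ e, F (π.setTerm n ω e) ∂gaussianReal 0 1 ∂π.gaussianLaw := by
  have hF' : Measurable fun p : π.Outcome × ℝ => F (π.setTerm n p.1 p.2) := by fun_prop
  rw [gaussianLaw, lintegral_prod _ hF.aemeasurable,
    lintegral_prod _ hF'.lintegral_prod_right'.aemeasurable]
  refine lintegral_congr fun s => ?_
  have hFs : Measurable fun p : (ℕ → ℝ) × ℝ => F (π.setTerm n (s, p.1) p.2) := by fun_prop
  rw [← infinitePi_map_update _ n, lintegral_map (by fun_prop) (by fun_prop),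
    infinitePi_map_update, ← lintegral_prod _ hFs.aemeasurable]
  rfl

/-- The first `t` observations when the unknown function is `g`. -/
noncomputable def trajectory (g : unitInterval → ℝ) (ω : π.Outcome) : (t : ℕ) → (Fin t → ℝ)
  | 0 => Fin.elim0
  | t + 1 =>
      Fin.snoc (α := fun _ => ℝ) (trajectory g ω t)
        (g (π.query t (ω.1, trajectory g ω t)) + ω.2 t)

theorem history_eq_trajectory {m : ℕ} (ν : CPEnvironment m) (ω : π.Outcome) (t : ℕ) :
    π.history ν ω t = π.trajectory ν.mean ω t := by
  induction t with
  | zero => rfl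
  | succ t ih => simp only [history, trajectory, ih]

/-- The seed together with the whole sequence of observations when the unknown function is `g`. -/
noncomputable def play (g : unitInterval → ℝ) (ω : π.Outcome) : π.Outcome :=
  (ω.1, fun t => π.trajectory g ω (t + 1) (Fin.last t))

theorem trunc_play (g : unitInterval → ℝ) (ω : π.Outcome) (n : ℕ) :
    π.trunc n (π.play g ω) = (ω.1, π.trajectory g ω n) := by
  refine Prod.ext rfl ?_
  induction n with
  | zero => exact funext fun i => i.elim0
  | succ n ih =>
    refine funext (Fin.lastCases rfl fun j => ?_)
    simpa [trajectory, trunc] using congrFun ih j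

/-- The query following the first `t` observations. -/
noncomputable def nextQuery (t : ℕ) (ω : π.Outcome) : unitInterval := π.query t (π.trunc t ω)

@[fun_prop]
theorem measurable_nextQuery (t : ℕ) : Measurable (π.nextQuery t) :=
  (π.measurable_query t).comp (π.measurable_trunc t)

theorem play_snd (g : unitInterval → ℝ) (ω : π.Outcome) (n : ℕ) :
    (π.play g ω).2 n = g (π.nextQuery n (π.play g ω)) + ω.2 n := by
  rw [nextQuery, trunc_play]
  simp [play, trajectory]

variable {π} in
theorem trunc_play_congr (g : unitInterval → ℝ) {n : ℕ} {ω ω' : π.Outcome}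
    (h : π.trunc n ω = π.trunc n ω') : π.trunc n (π.play g ω) = π.trunc n (π.play g ω') := by
  rw [trunc_eq_trunc_iff] at h
  have : ∀ k ≤ n, π.trajectory g ω k = π.trajectory g ω' k := by
    intro k
    induction k with
    | zero => exact fun _ => rfl
    | succ k ih => intro hk; simp only [trajectory, h.1, h.2 k hk, ih (Nat.le_of_succ_le hk)]
  rw [trunc_play, trunc_play, h.1, this n le_rfl]

theorem trunc_play_setTerm (g : unitInterval → ℝ) (n : ℕ) (ω : π.Outcome) (e : ℝ) :
    π.trunc (n + 1) (π.play g (π.setTerm n ω e))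
      = π.trunc (n + 1)
          (π.setTerm n (π.play g ω) (g (π.nextQuery n (π.play g ω)) + e)) := by
  have h := trunc_play_congr g (π.trunc_setTerm (le_refl n) ω e)
  refine trunc_eq_trunc_iff.2 ⟨rfl, fun t ht => ?_⟩
  obtain ht | rfl := Nat.lt_succ_iff_lt_or_eq.1 ht
  · simpa [setTerm, ht.ne] using (trunc_eq_trunc_iff.1 h).2 t ht
  · rw [play_snd, nextQuery, h]
    simp [setTerm, nextQuery]

theorem measurable_trajectory {g : unitInterval → ℝ} (hg : Measurable g) (n : ℕ) :
    Measurable fun ω : π.Outcome => π.trajectory g ω n := by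
  induction n with
  | zero => exact measurable_pi_lambda _ fun i => i.elim0
  | succ n ih =>
    have hquery := hg.comp ((π.measurable_query n).comp (measurable_fst.prodMk ih))
    refine measurable_pi_lambda _ (Fin.lastCases ?_ fun j => ?_)
    · simp only [trajectory, Fin.snoc_last]
      exact hquery.add (by fun_prop)
    · simp only [trajectory, Fin.snoc_castSucc]
      exact (measurable_pi_apply j).comp ih

@[fun_prop]
theorem measurable_play {g : unitInterval → ℝ} (hg : Measurable g) : Measurable (π.play g) :=
  measurable_fst.prodMk (measurable_pi_lambda _ fun t =>
    (measurable_pi_apply (Fin.last t)).comp (π.measurable_trajectory hg (t + 1)))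

/-- The law of the seed and the observations when the unknown function is `g` and the noise is
standard Gaussian. -/
noncomputable def traceLaw (g : unitInterval → ℝ) : Measure π.Outcome :=
  π.gaussianLaw.map (π.play g)

instance (g : unitInterval → ℝ) : IsZeroOrProbabilityMeasure (π.traceLaw g) := by
  unfold traceLaw; infer_instance

theorem isProbabilityMeasure_traceLaw {g : unitInterval → ℝ} (hg : Measurable g) :
    IsProbabilityMeasure (π.traceLaw g) :=
  Measure.isProbabilityMeasure_map (π.measurable_play hg).aemeasurable

theorem lintegral_traceLaw_next {g : unitInterval → ℝ} (hg : Measurable g) (n : ℕ)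
    {F : π.Outcome → ℝ≥0∞} (hF : Measurable F) (hF' : F.FactorsThrough (π.trunc (n + 1))) :
    ∫⁻ ω, F ω ∂π.traceLaw g
      = ∫⁻ ω, ∫⁻ e, F (π.setTerm n ω e) * ENNReal.ofReal
          (Real.exp (g (π.nextQuery n ω) * e - g (π.nextQuery n ω) ^ 2 / 2))
          ∂gaussianReal 0 1 ∂π.traceLaw g := by
  have hdensity : Measurable fun p : π.Outcome × ℝ => F (π.setTerm n p.1 p.2) * ENNReal.ofReal
      (Real.exp (g (π.nextQuery n p.1) * p.2 - g (π.nextQuery n p.1) ^ 2 / 2)) := by fun_prop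
  rw [traceLaw, lintegral_map hF (π.measurable_play hg),
    lintegral_map hdensity.lintegral_prod_right' (π.measurable_play hg),
    π.lintegral_gaussianLaw_eq_lintegral_setTerm n (F := fun ω => F (π.play g ω)) (by fun_prop)]
  refine lintegral_congr fun ω => ?_
  calc ∫⁻ e, F (π.play g (π.setTerm n ω e)) ∂gaussianReal 0 1
      = ∫⁻ e, F (π.setTerm n (π.play g ω) (g (π.nextQuery n (π.play g ω)) + e))
          ∂gaussianReal 0 1 := lintegral_congr fun e => hF' (π.trunc_play_setTerm g n ω e)
    _ = _ := lintegral_gaussianReal_const_add _ (F := fun e => F (π.setTerm n (π.play g ω) e))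
          (by fun_prop)

/-- The log-likelihood of `g` after `n` observations, relative to the zero function. -/
noncomputable def logLikelihood (g : unitInterval → ℝ) (n : ℕ) (ω : π.Outcome) : ℝ :=
  ∑ t ∈ Finset.range n, (g (π.nextQuery t ω) * ω.2 t - g (π.nextQuery t ω) ^ 2 / 2)

@[fun_prop]
theorem measurable_logLikelihood {g : unitInterval → ℝ} (hg : Measurable g) (n : ℕ) :
    Measurable (π.logLikelihood g n) := by
  unfold logLikelihood; fun_prop

theorem logLikelihood_succ_setTerm (g : unitInterval → ℝ) (n : ℕ) (ω : π.Outcome) (e : ℝ) :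
    π.logLikelihood g (n + 1) (π.setTerm n ω e)
      = π.logLikelihood g n ω + (g (π.nextQuery n ω) * e - g (π.nextQuery n ω) ^ 2 / 2) := by
  have hquery : ∀ t ≤ n, π.nextQuery t (π.setTerm n ω e) = π.nextQuery t ω := fun t ht => by
    rw [nextQuery, π.trunc_setTerm ht, nextQuery]
  rw [logLikelihood, Finset.sum_range_succ, hquery n le_rfl]
  congr 1
  · refine Finset.sum_congr rfl fun t ht => ?_
    have ht := Finset.mem_range.1 ht
    rw [hquery t ht.le]
    simp [setTerm, ht.ne]
  · simp [setTerm]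

theorem lintegral_traceLaw {g : unitInterval → ℝ} (hg : Measurable g) (n : ℕ)
    {F : π.Outcome → ℝ≥0∞} (hF : Measurable F) (hF' : F.FactorsThrough (π.trunc n)) :
    ∫⁻ ω, F ω ∂π.traceLaw g
      = ∫⁻ ω, F ω * ENNReal.ofReal (Real.exp (π.logLikelihood g n ω)) ∂π.gaussianLaw := by
  induction n generalizing F with
  | zero =>
    rw [traceLaw, lintegral_map hF (π.measurable_play hg)]
    refine lintegral_congr fun ω => ?_
    have htrunc : π.trunc 0 (π.play g ω) = π.trunc 0 ω :=
      trunc_eq_trunc_iff.2 ⟨rfl, fun t ht => absurd ht t.not_lt_zero⟩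
    simp [hF' htrunc, logLikelihood]
  | succ n ih =>
    have hdensity : Measurable fun p : π.Outcome × ℝ => F (π.setTerm n p.1 p.2) * ENNReal.ofReal
        (Real.exp (g (π.nextQuery n p.1) * p.2 - g (π.nextQuery n p.1) ^ 2 / 2)) := by fun_prop
    rw [π.lintegral_traceLaw_next hg n hF hF', ih hdensity.lintegral_prod_right' ?_,
      π.lintegral_gaussianLaw_eq_lintegral_setTerm n
        (F := fun ω => F ω * ENNReal.ofReal (Real.exp (π.logLikelihood g (n + 1) ω))) (by fun_prop)]
    · refine lintegral_congr fun ω => ?_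
      rw [← lintegral_mul_const _ (by fun_prop)]
      refine lintegral_congr fun e => ?_
      rw [logLikelihood_succ_setTerm, Real.exp_add, ENNReal.ofReal_mul (Real.exp_nonneg _)]
      ring
    · intro ω ω' h
      have hset (e : ℝ) : F (π.setTerm n ω e) = F (π.setTerm n ω' e) := by
        refine hF' (trunc_eq_trunc_iff.2 ⟨(trunc_eq_trunc_iff.1 h).1, fun t ht => ?_⟩)
        obtain ht | rfl := Nat.lt_succ_iff_lt_or_eq.1 ht
        · simpa [setTerm, ht.ne] using (trunc_eq_trunc_iff.1 h).2 t ht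
        · simp [setTerm]
      simp only [hset, nextQuery, h]

end CPAlgorithm

theorem exp_le_mul_exp_add_mul_exp {a b c K lam : ℝ} (hlam : 0 < lam)
    (h : 2 * a - b - c ≤ K) :
    Real.exp a ≤ lam / 2 * Real.exp b + Real.exp K / (2 * lam) * Real.exp c := by
  set x := Real.exp (b / 2) with hx
  set y := Real.exp ((K + c) / 2) with hy
  have exp_le : Real.exp a ≤ x * y := by
    rw [hx, hy, ← Real.exp_add, Real.exp_le_exp]
    linarith
  have sq_x : x ^ 2 = Real.exp b := by
    rw [hx, ← Real.exp_nat_mul]; push_cast; ring_nf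
  have sq_y : y ^ 2 = Real.exp K * Real.exp c := by
    rw [hy, ← Real.exp_nat_mul, ← Real.exp_add]; push_cast; ring_nf
  calc Real.exp a ≤ x * y := exp_le
    _ ≤ x * y + (lam * x - y) ^ 2 / (2 * lam) := le_add_of_nonneg_right (by positivity)
    _ = lam / 2 * x ^ 2 + y ^ 2 / (2 * lam) := by field_simp; ring
    _ = _ := by rw [sq_x, sq_y]; ring

namespace CPAlgorithm

variable {N : ℕ} (π : CPAlgorithm N)

/-- The filtration of the events decided by the seed and the first `n` observations. -/
def past : Filtration ℕ (inferInstance : MeasurableSpace π.Outcome) where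
  seq n := MeasurableSpace.comap (π.trunc n) inferInstance
  mono' k n hkn := by
    have h : Measurable fun p : π.Seed × (Fin n → ℝ) =>
        (p.1, fun i : Fin k => p.2 (Fin.castLE hkn i)) := by fun_prop
    exact (h.comp (comap_measurable (π.trunc n))).comap_le
  le' n := (π.measurable_trunc n).comap_le

theorem measurable_trunc_past {k n : ℕ} (h : k ≤ n) : Measurable[π.past n] (π.trunc k) :=
  (comap_measurable _).mono (π.past.mono h) le_rfl

theorem measurable_nextQuery_past {k n : ℕ} (h : k ≤ n) :
    Measurable[π.past n] (π.nextQuery k) :=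
  (π.measurable_query k).comp (π.measurable_trunc_past h)

theorem traceLaw_apply_eq_setLIntegral {g : unitInterval → ℝ} (hg : Measurable g) {n : ℕ}
    {C : Set π.Outcome} (hC : MeasurableSet[π.past n] C) :
    π.traceLaw g C
      = ∫⁻ ω in C, ENNReal.ofReal (Real.exp (π.logLikelihood g n ω)) ∂π.gaussianLaw := by
  have hC' : MeasurableSet C := π.past.le n _ hC
  have hfactor : (C.indicator (1 : π.Outcome → ℝ≥0∞)).FactorsThrough (π.trunc n) := by
    obtain ⟨B, -, rfl⟩ := hC
    intro ω ω' h
    exact congrArg (B.indicator 1) h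
  rw [← lintegral_indicator_one hC', π.lintegral_traceLaw hg n (measurable_one.indicator hC')
    hfactor, ← lintegral_indicator hC']
  exact lintegral_congr fun ω => by by_cases h : ω ∈ C <;> simp [h]

/-- The information accumulated by the first `n` queries on the difference of `g` and `h`. -/
noncomputable def information (g h : unitInterval → ℝ) (n : ℕ) (ω : π.Outcome) : ℝ :=
  ∑ t ∈ Finset.range n, (g (π.nextQuery t ω) - h (π.nextQuery t ω)) ^ 2

theorem two_mul_logLikelihood_sub (g h : unitInterval → ℝ) (n : ℕ) (ω : π.Outcome) :
    2 * π.logLikelihood g n ω - π.logLikelihood h n ω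
        - π.logLikelihood (fun x => 2 * g x - h x) n ω = π.information g h n ω := by
  simp only [logLikelihood, information, Finset.mul_sum, ← Finset.sum_sub_distrib]
  exact Finset.sum_congr rfl fun t _ => by ring

theorem traceLaw_le_of_information_le {g h : unitInterval → ℝ} (hg : Measurable g)
    (hh : Measurable h) {n : ℕ} {C : Set π.Outcome} (hC : MeasurableSet[π.past n] C) {K lam : ℝ}
    (hlam : 0 < lam) (hK : ∀ ω ∈ C, π.information g h n ω ≤ K) :
    π.traceLaw g C ≤ ENNReal.ofReal (lam / 2) * π.traceLaw h C
      + ENNReal.ofReal (Real.exp K / (2 * lam)) * π.traceLaw (fun x => 2 * g x - h x) C := by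
  have hk : Measurable fun x => 2 * g x - h x := by fun_prop
  rw [π.traceLaw_apply_eq_setLIntegral hg hC, π.traceLaw_apply_eq_setLIntegral hh hC,
    π.traceLaw_apply_eq_setLIntegral hk hC, ← lintegral_const_mul _ (by fun_prop),
    ← lintegral_const_mul _ (by fun_prop), ← lintegral_add_left (by fun_prop)]
  refine setLIntegral_mono (by fun_prop) fun ω hω => ?_
  rw [← ENNReal.ofReal_mul (by positivity), ← ENNReal.ofReal_mul (by positivity),
    ← ENNReal.ofReal_add (by positivity) (by positivity)]
  exact ENNReal.ofReal_le_ofReal (exp_le_mul_exp_add_mul_exp hlam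
    ((π.two_mul_logLikelihood_sub g h n ω).le.trans (hK ω hω)))

theorem traceLaw_iUnion_le_of_information_le {ι : Type*} [Countable ι] {g h : unitInterval → ℝ}
    (hg : Measurable g) (hh : Measurable h) {T : ι → ℕ} {C : ι → Set π.Outcome}
    (hC : ∀ i, MeasurableSet[π.past (T i)] (C i)) (hdisj : Pairwise (Function.onFun Disjoint C))
    {K lam : ℝ} (hlam : 0 < lam) (hK : ∀ i, ∀ ω ∈ C i, π.information g h (T i) ω ≤ K) :
    (π.traceLaw g).real (⋃ i, C i)
      ≤ lam / 2 * (π.traceLaw h).real (⋃ i, C i) + Real.exp K / (2 * lam) := by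
  have hC' (i : ι) : MeasurableSet (C i) := π.past.le _ _ (hC i)
  refine ENNReal.toReal_le_of_le_ofReal (by positivity) ?_
  rw [ENNReal.ofReal_add (by positivity) (by positivity), ENNReal.ofReal_mul (by positivity),
    ofReal_measureReal]
  calc π.traceLaw g (⋃ i, C i) = ∑' i, π.traceLaw g (C i) := measure_iUnion hdisj hC'
    _ ≤ ∑' i, (ENNReal.ofReal (lam / 2) * π.traceLaw h (C i) + ENNReal.ofReal
          (Real.exp K / (2 * lam)) * π.traceLaw (fun x => 2 * g x - h x) (C i)) :=
        ENNReal.tsum_le_tsum fun i => π.traceLaw_le_of_information_le hg hh (hC i) hlam (hK i)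
    _ = ENNReal.ofReal (lam / 2) * π.traceLaw h (⋃ i, C i) + ENNReal.ofReal
          (Real.exp K / (2 * lam)) * π.traceLaw (fun x => 2 * g x - h x) (⋃ i, C i) := by
        rw [ENNReal.tsum_add, ENNReal.tsum_mul_left, ENNReal.tsum_mul_left,
          measure_iUnion hdisj hC', measure_iUnion hdisj hC']
    _ ≤ _ := by
        gcongr
        exact mul_le_of_le_one_right' prob_le_one

/-- The number of observations made before halting. -/
noncomputable def duration (ω : π.Outcome) : ℕ∞ :=
  ⨅ (t : ℕ) (_ : π.trunc t ω ∈ π.haltSet t), (t : ℕ∞)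

theorem lt_duration_iff (ω : π.Outcome) (n : ℕ) :
    (n : ℕ∞) < π.duration ω ↔ ∀ t ≤ n, π.trunc t ω ∉ π.haltSet t := by
  rw [← Order.add_one_le_iff_of_not_isMax (by simp), duration, le_iInf₂_iff]
  norm_cast
  exact forall_congr' fun t => by rw [Nat.succ_le_iff, ← not_imp_not, not_lt]

theorem isStoppingTime_duration : IsStoppingTime π.past π.duration := by
  intro n
  have : {ω | π.duration ω ≤ n} = ⋃ t ≤ n, π.trunc t ⁻¹' π.haltSet t := by
    ext ω
    have := π.lt_duration_iff ω n
    simpa using not_congr this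
  change MeasurableSet[π.past n] {ω | π.duration ω ≤ n}
  rw [this]
  exact .biUnion (Set.to_countable _) fun t ht =>
    π.measurable_trunc_past ht (π.measurableSet_haltSet t)

theorem measurableSet_lt_duration (n : ℕ) :
    MeasurableSet[π.past n] {ω | (n : ℕ∞) < π.duration ω} :=
  π.isStoppingTime_duration.measurableSet_gt n

theorem measurableSet_duration_eq (n : ℕ) :
    MeasurableSet[π.past n] {ω | π.duration ω = n} :=
  π.isStoppingTime_duration.measurableSet_eq n

open Classical in
/-- The number of the first `n` queries that fall in `J`. -/
noncomputable def count (J : Set unitInterval) (n : ℕ) (ω : π.Outcome) : ℕ :=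
  ∑ t ∈ Finset.range n, if π.nextQuery t ω ∈ J then 1 else 0

/-- The number of queries made in `J` before halting. -/
noncomputable def visits (J : Set unitInterval) (ω : π.Outcome) : ℝ≥0∞ :=
  ∑' t : ℕ, {t : ℕ | (t : ℕ∞) < π.duration ω ∧ π.nextQuery t ω ∈ J}.indicator 1 t

theorem visits_eq_count (J : Set unitInterval) {ω : π.Outcome} {n : ℕ} (h : π.duration ω = n) :
    π.visits J ω = π.count J n ω := by
  classical
  rw [visits, tsum_eq_sum (s := Finset.range n) fun t ht => by simp_all, count]
  push_cast
  refine Finset.sum_congr rfl fun t ht => ?_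
  have : t < n := Finset.mem_range.1 ht
  simp [Set.indicator_apply, h, this]

theorem visits_univ (ω : π.Outcome) : π.visits Set.univ ω = (π.duration ω : ℝ≥0∞) := by
  obtain h | ⟨n, h⟩ : π.duration ω = ⊤ ∨ ∃ n : ℕ, π.duration ω = n := by
    cases π.duration ω using ENat.recTopCoe <;> simp
  · simp [visits, h]
  · rw [visits_eq_count π _ h, h]
    simp [count]

theorem measurable_visits {J : Set unitInterval} (hJ : MeasurableSet J) :
    Measurable (π.visits J) := by
  classical
  unfold visits
  simp only [Set.indicator_apply]
  refine Measurable.tsum fun t => Measurable.ite ?_ measurable_const measurable_const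
  exact (π.past.le t _ (π.measurableSet_lt_duration t)).inter (π.measurable_nextQuery t hJ)

theorem sum_visits_le {ι : Type*} (S : Finset ι) {J : ι → Set unitInterval}
    (hJ : (S : Set ι).PairwiseDisjoint J) (ω : π.Outcome) :
    ∑ i ∈ S, π.visits (J i) ω ≤ (π.duration ω : ℝ≥0∞) := by
  rw [← visits_univ]
  unfold visits
  rw [← Summable.tsum_finsetSum fun i _ => ENNReal.summable]
  refine ENNReal.tsum_le_tsum fun t => ?_
  have hdisj : (S : Set ι).PairwiseDisjoint
      fun i => {t : ℕ | (t : ℕ∞) < π.duration ω ∧ π.nextQuery t ω ∈ J i} := fun i hi j hj hij =>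
    Set.disjoint_left.2 fun t ht ht' => Set.disjoint_left.1 (hJ hi hj hij) ht.2 ht'.2
  rw [← Finset.indicator_biUnion_apply S _ hdisj]
  refine Set.indicator_le_indicator_of_subset ?_ (fun _ => zero_le) t
  exact Set.iUnion₂_subset fun i _ t ht => ⟨ht.1, trivial⟩

theorem count_mono (J : Set unitInterval) (ω : π.Outcome) : Monotone fun n => π.count J n ω :=
  fun _ _ h => Finset.sum_le_sum_of_subset (Finset.range_mono h)

theorem count_succ_le (J : Set unitInterval) (n : ℕ) (ω : π.Outcome) :
    π.count J (n + 1) ω ≤ π.count J n ω + 1 := by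
  rw [count, Finset.sum_range_succ]
  gcongr
  · rfl
  · split_ifs <;> simp

theorem sum_count_le {ι : Type*} (S : Finset ι) {J : ι → Set unitInterval}
    (hJ : (S : Set ι).PairwiseDisjoint J) (n : ℕ) (ω : π.Outcome) :
    ∑ i ∈ S, π.count (J i) n ω ≤ n := by
  classical
  unfold count
  rw [Finset.sum_comm]
  calc ∑ t ∈ Finset.range n, ∑ i ∈ S, (if π.nextQuery t ω ∈ J i then 1 else 0)
      ≤ ∑ t ∈ Finset.range n, 1 := Finset.sum_le_sum fun t _ => ?_
    _ = n := by simp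
  rw [Finset.sum_boole, Nat.cast_id, Finset.card_le_one]
  simp only [Finset.mem_filter]
  exact fun i hi j hj => hJ.elim_set hi.1 hj.1 _ hi.2 hj.2

theorem measurable_count_past {J : Set unitInterval} (hJ : MeasurableSet J) {k n : ℕ}
    (h : k ≤ n) : Measurable[π.past n] (π.count J k) := by
  unfold count
  refine Finset.measurable_sum _ fun t ht => Measurable.ite ?_ measurable_const measurable_const
  exact π.measurable_nextQuery_past ((Finset.mem_range.1 ht).le.trans h) hJ

end CPAlgorithm

/-- `g` is a measurable perturbation of `h` that differs from `h` only in `J`, by at most `d`. -/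
structure IsLocalPerturbation (g h : unitInterval → ℝ) (J : Set unitInterval) (d : ℝ) : Prop where
  measurable_left : Measurable g
  measurable_right : Measurable h
  measurableSet : MeasurableSet J
  eq_off : ∀ x ∉ J, g x = h x
  sq_sub_le : ∀ x, (g x - h x) ^ 2 ≤ d ^ 2

namespace CPAlgorithm

variable {N : ℕ} (π : CPAlgorithm N)

/-- The event that the algorithm halts, at a time `n` for which the outcome lies in `A n`. -/
def haltsIn (A : ℕ → Set π.Outcome) : Set π.Outcome :=
  ⋃ n : ℕ, {ω | π.duration ω = n} ∩ A n

variable {π} in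
theorem mem_haltsIn {A : ℕ → Set π.Outcome} {ω : π.Outcome} :
    ω ∈ π.haltsIn A ↔ ∃ n : ℕ, π.duration ω = n ∧ ω ∈ A n := by
  simp [haltsIn]

theorem measurableSet_haltsIn {A : ℕ → Set π.Outcome}
    (hA : ∀ n, MeasurableSet[π.past n] (A n)) : MeasurableSet (π.haltsIn A) :=
  .iUnion fun n => π.past.le n _ ((π.measurableSet_duration_eq n).inter (hA n))

theorem disjoint_haltsIn {A B : ℕ → Set π.Outcome} (h : ∀ n, Disjoint (A n) (B n)) :
    Disjoint (π.haltsIn A) (π.haltsIn B) := by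
  refine Set.disjoint_left.2 fun ω hA hB => ?_
  obtain ⟨n, hn, hωA⟩ := mem_haltsIn.1 hA
  obtain ⟨k, hk, hωB⟩ := mem_haltsIn.1 hB
  obtain rfl : n = k := by exact_mod_cast hn.symm.trans hk
  exact Set.disjoint_left.1 (h n) hωA hωB

variable {g h : unitInterval → ℝ} {J : Set unitInterval} {d : ℝ}

theorem information_le (hgh : IsLocalPerturbation g h J d) (n : ℕ) (ω : π.Outcome) :
    π.information g h n ω ≤ d ^ 2 * π.count J n ω := by
  rw [information, count]
  push_cast
  rw [Finset.mul_sum]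
  refine Finset.sum_le_sum fun t _ => ?_
  split_ifs with ht
  · simpa using hgh.sq_sub_le (π.nextQuery t ω)
  · simp [hgh.eq_off _ ht]

theorem traceLaw_haltsIn_le (hgh : IsLocalPerturbation g h J d) {A : ℕ → Set π.Outcome}
    (hA : ∀ n, MeasurableSet[π.past n] (A n)) {r lam : ℝ} (hr : 0 ≤ r) (hlam : 0 < lam) :
    (π.traceLaw g).real (π.haltsIn A)
      ≤ lam / 2 * (π.traceLaw h).real (π.haltsIn A) + Real.exp (d ^ 2 * r) / (2 * lam)
        + (π.traceLaw g).real {ω | ENNReal.ofReal r < π.visits J ω} := by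
  set C : ℕ → Set π.Outcome := fun n =>
    {ω | π.duration ω = n} ∩ A n ∩ {ω | (π.count J n ω : ℝ) ≤ r}
  have hC (n : ℕ) : MeasurableSet[π.past n] (C n) := by
    refine ((π.measurableSet_duration_eq n).inter (hA n)).inter ?_
    exact π.measurable_count_past hgh.measurableSet le_rfl
      (MeasurableSet.of_discrete (s := {k : ℕ | (k : ℝ) ≤ r}))
  have hdisj : Pairwise (Function.onFun Disjoint C) := fun n k hnk =>
    Set.disjoint_left.2 fun ω hn hk => hnk (by exact_mod_cast hn.1.1.symm.trans hk.1.1)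
  have hsub : π.haltsIn A ⊆ (⋃ n, C n) ∪ {ω | ENNReal.ofReal r < π.visits J ω} := by
    intro ω hω
    obtain ⟨n, hn, hωA⟩ := mem_haltsIn.1 hω
    refine (le_or_gt (π.count J n ω : ℝ) r).imp (fun hle => Set.mem_iUnion.2 ⟨n, ⟨hn, hωA⟩, hle⟩)
      fun hlt => ?_
    rw [Set.mem_ofPred_eq, π.visits_eq_count J hn, ← ENNReal.ofReal_natCast]
    exact (ENNReal.ofReal_lt_ofReal_iff (hr.trans_lt hlt)).2 hlt
  have hle : (π.traceLaw g).real (⋃ n, C n)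
      ≤ lam / 2 * (π.traceLaw h).real (⋃ n, C n) + Real.exp (d ^ 2 * r) / (2 * lam) :=
    π.traceLaw_iUnion_le_of_information_le hgh.measurable_left hgh.measurable_right hC hdisj hlam
      fun n ω hω => (π.information_le hgh n ω).trans (by gcongr; exact hω.2)
  calc (π.traceLaw g).real (π.haltsIn A)
      ≤ (π.traceLaw g).real (⋃ n, C n) + _ :=
        (measureReal_mono hsub).trans (measureReal_union_le _ _)
    _ ≤ _ := by
        refine add_le_add_left (hle.trans ?_) _
        gcongr ?_ * ?_ + _
        exact measureReal_mono (Set.iUnion_mono fun n => Set.inter_subset_left)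

theorem traceLaw_lt_count_le (hgh : IsLocalPerturbation g h J d) (τ : ℕ) {r lam : ℝ}
    (hr : 0 ≤ r) (hlam : 0 < lam) :
    (π.traceLaw g).real {ω | r < π.count J τ ω}
      ≤ lam / 2 * (π.traceLaw h).real {ω | r < π.count J τ ω}
        + Real.exp (d ^ 2 * (r + 1)) / (2 * lam) := by
  set C : Fin τ → Set π.Outcome := fun n =>
    {ω | r ∈ Set.Ico (π.count J n ω : ℝ) (π.count J (n + 1) ω)}
  have hcount (ω : π.Outcome) : Monotone fun n => (π.count J n ω : ℝ) :=
    fun _ _ h => Nat.cast_le.2 (π.count_mono J ω h)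
  have hC (n : Fin τ) : MeasurableSet[π.past (n + 1)] (C n) := by
    have hle := π.measurable_count_past hgh.measurableSet (Nat.le_succ n)
      (MeasurableSet.of_discrete (s := {k : ℕ | (k : ℝ) ≤ r}))
    have hlt := π.measurable_count_past hgh.measurableSet (le_refl (n + 1 : ℕ))
      (MeasurableSet.of_discrete (s := {k : ℕ | r < (k : ℝ)}))
    exact hle.inter hlt
  have hdisj : Pairwise (Function.onFun Disjoint C) := fun n k hnk =>
    Set.disjoint_left.2 fun ω hn hk => Set.disjoint_left.1
      ((hcount ω).pairwise_disjoint_on_Ico_succ (Fin.val_ne_of_ne hnk)) hn hk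
  have hunion : {ω | r < π.count J τ ω} = ⋃ n, C n := by
    ext ω
    simp only [Set.mem_ofPred_eq, Set.mem_iUnion, C]
    refine ⟨fun hlt => ?_, fun ⟨n, hn⟩ => hn.2.trans_le (hcount ω n.2)⟩
    by_contra! hnot
    have hle : ∀ n ≤ τ, (π.count J n ω : ℝ) ≤ r := fun n hn => by
      induction n with
      | zero => simpa [count] using hr
      | succ n ih => exact not_lt.1 fun h => hnot ⟨n, hn⟩ ⟨ih (Nat.le_of_succ_le hn), h⟩
    exact (hle τ le_rfl).not_gt hlt
  rw [hunion]
  refine π.traceLaw_iUnion_le_of_information_le hgh.measurable_left hgh.measurable_right hC hdisj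
    hlam fun n ω hω => (π.information_le hgh _ ω).trans ?_
  gcongr
  have : (π.count J (n + 1) ω : ℝ) ≤ π.count J n ω + 1 := by exact_mod_cast π.count_succ_le J n ω
  linarith [hω.1]

theorem ofReal_mul_traceLaw_le_lintegral_visits (hJ : MeasurableSet J) (g : unitInterval → ℝ)
    {r : ℝ} (hr : 0 ≤ r) :
    ENNReal.ofReal (r * (π.traceLaw g).real {ω | ENNReal.ofReal r < π.visits J ω})
      ≤ ∫⁻ ω, π.visits J ω ∂π.traceLaw g := by
  rw [ENNReal.ofReal_mul hr, ofReal_measureReal]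
  refine le_trans ?_ (mul_meas_ge_le_lintegral (π.measurable_visits hJ) (ENNReal.ofReal r))
  gcongr with ω
  exact le_of_lt

theorem lintegral_visits_ge_of_haltsIn (hgh : IsLocalPerturbation g h J d) {A : ℕ → Set π.Outcome}
    (hA : ∀ n, MeasurableSet[π.past n] (A n)) {δ : ℝ} (hδ : 0 < δ) (hδ' : δ < 1 / 16)
    (hg : 1 - δ ≤ (π.traceLaw g).real (π.haltsIn A))
    (hh : (π.traceLaw h).real (π.haltsIn A) ≤ δ) :
    ENNReal.ofReal (7 / 16 * (1 / d ^ 2 * Real.log (1 / (4 * δ))))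
      ≤ ∫⁻ ω, π.visits J ω ∂π.traceLaw g := by
  set r := 1 / d ^ 2 * Real.log (1 / (4 * δ)) with hr_def
  have hlog : 0 ≤ Real.log (1 / (4 * δ)) :=
    Real.log_nonneg ((one_le_div (by positivity)).2 (by linarith))
  have hr : 0 ≤ r := by positivity
  have hexp : Real.exp (d ^ 2 * r) ≤ 1 / (4 * δ) := by
    rw [← Real.le_log_iff_exp_le (by positivity), hr_def, ← mul_assoc, mul_one_div]
    exact mul_le_of_le_one_left hlog (div_self_le_one _)
  have hle := π.traceLaw_haltsIn_le hgh hA hr (lam := 1 / (2 * δ)) (by positivity)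
  have h₁ : 1 / (2 * δ) / 2 * (π.traceLaw h).real (π.haltsIn A) ≤ 1 / 4 :=
    (mul_le_mul_of_nonneg_left hh (by positivity)).trans_eq (by field_simp; norm_num)
  have h₂ : Real.exp (d ^ 2 * r) / (2 * (1 / (2 * δ))) ≤ 1 / 4 :=
    (div_le_div_of_nonneg_right hexp (by positivity)).trans_eq (by field_simp)
  refine le_trans (ENNReal.ofReal_le_ofReal ?_)
    (π.ofReal_mul_traceLaw_le_lintegral_visits hgh.measurableSet g hr)
  rw [mul_comm]
  gcongr
  linarith

theorem sum_lintegral_visits_ge_of_disjoint {ι : Type*} [Fintype ι] {g : ι → unitInterval → ℝ}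
    (hgh : ∀ k, IsLocalPerturbation (g k) h J d) {A : ι → ℕ → Set π.Outcome}
    (hA : ∀ k n, MeasurableSet[π.past n] (A k n))
    (hdisj : Pairwise (Function.onFun Disjoint fun k => π.haltsIn (A k)))
    (hg : ∀ k, 15 / 16 ≤ (π.traceLaw (g k)).real (π.haltsIn (A k))) :
    ENNReal.ofReal (Fintype.card ι * (7 / 16 * (1 / d ^ 2 * Real.posLog (Fintype.card ι / 4))))
      ≤ ∑ k, ∫⁻ ω, π.visits J ω ∂π.traceLaw (g k) := by
  set K : ℝ := (Fintype.card ι : ℝ)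
  obtain hK | hK := lt_or_ge K 4
  · rw [Real.posLog_eq_zero_iff _ |>.2 (by rw [abs_of_nonneg (by positivity)]; linarith)]
    simp
  have : 0 < K := by linarith
  set r := 1 / d ^ 2 * Real.posLog (K / 4) with hr_def
  have hr : 0 ≤ r := mul_nonneg (by positivity) Real.posLog_nonneg
  have hexp : Real.exp (d ^ 2 * r) ≤ K / 4 := by
    rw [← Real.le_log_iff_exp_le (by positivity), hr_def, ← mul_assoc, mul_one_div,
      Real.posLog_eq_log (by rw [abs_of_nonneg (by positivity)]; linarith)]
    exact mul_le_of_le_one_left (Real.log_nonneg (by linarith)) (div_self_le_one _)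
  have hle (k : ι) : 15 / 16 ≤ K / 4 * (π.traceLaw h).real (π.haltsIn (A k)) + 1 / 4
      + (π.traceLaw (g k)).real {ω | ENNReal.ofReal r < π.visits J ω} := by
    have h₁ := π.traceLaw_haltsIn_le (hgh k) (hA k) hr (lam := K / 2) (by positivity)
    have h₂ : Real.exp (d ^ 2 * r) / (2 * (K / 2)) ≤ 1 / 4 :=
      (div_le_div_of_nonneg_right hexp (by positivity)).trans_eq (by field_simp)
    linarith [hg k]
  have hone : ∑ k, (π.traceLaw h).real (π.haltsIn (A k)) ≤ 1 := by
    rw [← measureReal_iUnion_fintype hdisj fun k => π.measurableSet_haltsIn (hA k)]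
    exact measureReal_le_one
  have hsum : K * (7 / 16)
      ≤ ∑ k, (π.traceLaw (g k)).real {ω | ENNReal.ofReal r < π.visits J ω} := by
    have := Finset.sum_le_sum fun k (_ : k ∈ Finset.univ) => hle k
    simp only [Finset.sum_add_distrib, ← Finset.mul_sum, Finset.sum_const, Finset.card_univ,
      nsmul_eq_mul] at this
    nlinarith
  calc ENNReal.ofReal (K * (7 / 16 * r))
      ≤ ENNReal.ofReal
          (∑ k, r * (π.traceLaw (g k)).real {ω | ENNReal.ofReal r < π.visits J ω}) := by
        rw [← Finset.mul_sum]
        exact ENNReal.ofReal_le_ofReal (by nlinarith)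
    _ = ∑ k, ENNReal.ofReal
          (r * (π.traceLaw (g k)).real {ω | ENNReal.ofReal r < π.visits J ω}) :=
        ENNReal.ofReal_sum_of_nonneg fun k _ => by positivity
    _ ≤ _ := Finset.sum_le_sum fun k _ =>
        π.ofReal_mul_traceLaw_le_lintegral_visits (hgh k).measurableSet (g k) hr

theorem ofReal_mul_traceLaw_le_lintegral_duration (g : unitInterval → ℝ) (τ : ℕ) :
    ENNReal.ofReal ((τ + 1) * (π.traceLaw g).real {ω | (τ : ℕ∞) < π.duration ω})
      ≤ ∫⁻ ω, (π.duration ω : ℝ≥0∞) ∂π.traceLaw g := by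
  have hmeas : Measurable fun ω => (π.duration ω : ℝ≥0∞) := by
    simp only [← visits_univ]
    exact π.measurable_visits .univ
  rw [ENNReal.ofReal_mul (by positivity), ofReal_measureReal]
  refine le_trans ?_ (mul_meas_ge_le_lintegral hmeas (ENNReal.ofReal (τ + 1)))
  gcongr with ω
  intro hω
  rw [ENNReal.ofReal_add (by positivity) zero_le_one, ENNReal.ofReal_natCast, ENNReal.ofReal_one]
  exact_mod_cast Order.add_one_le_of_lt hω

theorem sum_traceLaw_lt_count_le {ι : Type*} [Fintype ι] (hh : Measurable h)
    {J : ι → Set unitInterval} (hJ : ∀ k, MeasurableSet (J k))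
    (hdisj : Pairwise (Function.onFun Disjoint J)) (τ : ℕ) {r : ℝ} (hr : 0 < r) :
    ∑ k, (π.traceLaw h).real {ω | r < π.count (J k) τ ω} ≤ τ / r := by
  have := π.isProbabilityMeasure_traceLaw hh
  have hsum (ω : π.Outcome) : ∑ k, (π.count (J k) τ ω : ℝ) ≤ τ := by
    exact_mod_cast π.sum_count_le Finset.univ (hdisj.set_pairwise _) τ ω
  have hle (k : ι) (ω : π.Outcome) : (π.count (J k) τ ω : ℝ) ≤ τ :=
    (Finset.single_le_sum (f := fun k => (π.count (J k) τ ω : ℝ)) (fun _ _ => by positivity)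
      (Finset.mem_univ k)).trans (hsum ω)
  have hint (k : ι) : Integrable (fun ω => (π.count (J k) τ ω : ℝ)) (π.traceLaw h) := by
    have : Measurable (π.count (J k) τ) :=
      (π.measurable_count_past (hJ k) le_rfl).mono (π.past.le τ) le_rfl
    exact .of_bound (by fun_prop) τ (.of_forall fun ω => by simpa using hle k ω)
  rw [le_div_iff₀' hr, Finset.mul_sum]
  calc ∑ k, r * (π.traceLaw h).real {ω | r < π.count (J k) τ ω}
      ≤ ∑ k, ∫ ω, (π.count (J k) τ ω : ℝ) ∂π.traceLaw h := by
        refine Finset.sum_le_sum fun k _ => le_trans ?_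
          (mul_meas_ge_le_integral_of_nonneg (.of_forall fun ω => by positivity) (hint k) r)
        exact mul_le_mul_of_nonneg_left (measureReal_mono fun ω hω => hω.out.le) hr.le
    _ = ∫ ω, ∑ k, (π.count (J k) τ ω : ℝ) ∂π.traceLaw h :=
        (integral_finsetSum _ fun k _ => hint k).symm
    _ ≤ ∫ _, (τ : ℝ) ∂π.traceLaw h :=
        integral_mono (integrable_finsetSum _ fun k _ => hint k) (integrable_const _) hsum
    _ = τ := by simp

theorem visits_le_count_of_duration_le (J : Set unitInterval) {ω : π.Outcome} {τ : ℕ}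
    (h : π.duration ω ≤ τ) : π.visits J ω ≤ π.count J τ ω := by
  obtain ⟨n, hn⟩ := ENat.ne_top_iff_exists.1 (ne_top_of_le_ne_top (ENat.natCast_ne_top τ) h)
  rw [π.visits_eq_count J hn.symm]
  exact_mod_cast π.count_mono J ω (by rwa [← hn, Nat.cast_le] at h)

theorem traceLaw_haltsIn_le_add_lt_duration (hgh : IsLocalPerturbation g h J d) (hd : d ≠ 0)
    (hd' : d ^ 2 ≤ 1) {A : ℕ → Set π.Outcome} (hA : ∀ n, MeasurableSet[π.past n] (A n))
    (hh : (π.traceLaw h).real (π.haltsIn A) ≤ 1 / 2) (τ : ℕ) :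
    (π.traceLaw g).real (π.haltsIn A)
      ≤ 25 / 32 + 32 * (π.traceLaw h).real {ω | 1 / (10 * d ^ 2) < π.count J τ ω}
        + (π.traceLaw g).real {ω | (τ : ℕ∞) < π.duration ω} := by
  set r := 1 / (10 * d ^ 2) with hr_def
  have hr : 0 ≤ r := by positivity
  have hdr : d ^ 2 * r = 1 / 10 := by rw [hr_def]; field_simp
  have hsub : {ω | ENNReal.ofReal r < π.visits J ω}
      ⊆ {ω | r < π.count J τ ω} ∪ {ω | (τ : ℕ∞) < π.duration ω} := by
    refine fun ω hω => (lt_or_ge (τ : ℕ∞) (π.duration ω)).elim Or.inr fun hle => Or.inl ?_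
    have hlt : ENNReal.ofReal r < π.count J τ ω :=
      lt_of_lt_of_le hω (π.visits_le_count_of_duration_le J hle)
    rwa [← ENNReal.ofReal_natCast, ENNReal.ofReal_lt_ofReal_iff_of_nonneg hr] at hlt
  have hvisits := (measureReal_mono (μ := π.traceLaw g) hsub).trans (measureReal_union_le _ _)
  have hcount := π.traceLaw_lt_count_le hgh τ hr (lam := 64) (by norm_num)
  have hhalt := π.traceLaw_haltsIn_le hgh hA hr (lam := 3 / 2) (by norm_num)
  have hexp : Real.exp (d ^ 2 * r) ≤ 9 / 8 := by
    rw [hdr]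
    exact (Real.exp_bound_div_one_sub_of_interval (by norm_num) (by norm_num)).trans (by norm_num)
  have hexp' : Real.exp (d ^ 2 * (r + 1)) ≤ 4 := by
    have : Real.exp (d ^ 2 * 1) ≤ 3 :=
      (Real.exp_le_exp.2 (by linarith)).trans Real.exp_one_lt_three.le
    rw [mul_add, Real.exp_add]
    nlinarith [Real.exp_pos (d ^ 2 * r)]
  linarith

theorem exists_lintegral_duration_ge_of_disjoint {ι : Type*} [Fintype ι] [Nonempty ι]
    {g : ι → unitInterval → ℝ} {J : ι → Set unitInterval}
    (hgh : ∀ k, IsLocalPerturbation (g k) h (J k) d) (hd : d ≠ 0) (hd' : d ^ 2 ≤ 1)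
    (hdisj : Pairwise (Function.onFun Disjoint J)) {A : ℕ → Set π.Outcome}
    (hA : ∀ n, MeasurableSet[π.past n] (A n))
    (hh : (π.traceLaw h).real (π.haltsIn A) ≤ 1 / 2)
    (hg : ∀ k, 15 / 16 ≤ (π.traceLaw (g k)).real (π.haltsIn A)) :
    ∃ k, ENNReal.ofReal (Fintype.card ι / (81920 * d ^ 2))
      ≤ ∫⁻ ω, (π.duration ω : ℝ≥0∞) ∂π.traceLaw (g k) := by
  set τ := ⌊Fintype.card ι / (10240 * d ^ 2)⌋₊
  have hτ : τ ≤ Fintype.card ι / (10240 * d ^ 2) := Nat.floor_le (by positivity)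
  have hτ' : Fintype.card ι / (10240 * d ^ 2) < τ + 1 := Nat.lt_floor_add_one _
  obtain ⟨k, -, hk⟩ : ∃ k ∈ Finset.univ,
      (π.traceLaw h).real {ω | 1 / (10 * d ^ 2) < π.count (J k) τ ω} ≤ 1 / 1024 := by
    refine Finset.exists_le_of_sum_le Finset.univ_nonempty
      ((π.sum_traceLaw_lt_count_le (hgh (Classical.arbitrary ι)).measurable_right
        (fun k => (hgh k).measurableSet) hdisj τ (by positivity)).trans ?_)
    rw [le_div_iff₀ (by positivity)] at hτ
    simp only [one_div, div_inv_eq_mul, Finset.sum_const, Finset.card_univ, nsmul_eq_mul]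
    linarith
  refine ⟨k, (ENNReal.ofReal_le_ofReal ?_).trans
    (π.ofReal_mul_traceLaw_le_lintegral_duration (g k) τ)⟩
  have hlong : 1 / 8 ≤ (π.traceLaw (g k)).real {ω | (τ : ℕ∞) < π.duration ω} := by
    have := π.traceLaw_haltsIn_le_add_lt_duration (hgh k) hd hd' hA hh τ
    linarith [hg k]
  calc Fintype.card ι / (81920 * d ^ 2) = Fintype.card ι / (10240 * d ^ 2) * (1 / 8) := by ring
    _ ≤ (τ + 1) * (π.traceLaw (g k)).real {ω | (τ : ℕ∞) < π.duration ω} := by gcongr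

end CPAlgorithm

theorem hasSubgaussianMGF_gaussianReal :
    HasSubgaussianMGF (fun e : ℝ => e) 1 (gaussianReal 0 1) where
  integrable_exp_mul t := integrable_exp_mul_gaussianReal t
  mgf_le t := by simp [mgf_fun_id_gaussianReal]

/-- The points of the unit interval that lie in `[a, b)`. -/
def window (a b : ℝ) : Set unitInterval := (↑) ⁻¹' Set.Ico a b

theorem measurableSet_window (a b : ℝ) : MeasurableSet (window a b) :=
  measurable_subtype_coe measurableSet_Ico

theorem disjoint_window {a b a' b' : ℝ} (h : b ≤ a') : Disjoint (window a b) (window a' b') :=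
  (Set.Ico_disjoint_Ico.2 (by simp [h])).preimage _

namespace CPEnvironment

variable {m : ℕ}

/-- The environment with standard Gaussian noise, baseline zero, and given positions and jumps. -/
noncomputable def gaussian (p D : Fin m → ℝ) (hp : StrictMono p)
    (hp' : ∀ i, p i ∈ Set.Ioo (0 : ℝ) 1) (hD : ∀ i, D i ≠ 0) (hD' : ∀ i, |D i| ≤ 1) :
    CPEnvironment m where
  baseline := 0
  pos := p
  pos_strictMono := hp
  pos_mem := hp'
  jump := D
  jump_ne_zero := hD
  abs_jump_le_one := hD'
  noise := gaussianReal 0 1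
  noise_prob := inferInstance
  noise_mean := integral_id_gaussianReal
  noise_subgaussian := hasSubgaussianMGF_gaussianReal

theorem measurable_mean (ν : CPEnvironment m) : Measurable ν.mean := by
  unfold mean
  refine measurable_const.add (Finset.measurable_sum _ fun i _ => ?_)
  exact .ite (measurable_subtype_coe measurableSet_Ici) measurable_const measurable_const

theorem mean_sub_mean {μ μ' : CPEnvironment m} (hbase : μ.baseline = μ'.baseline)
    (hjump : μ.jump = μ'.jump) {i : Fin m} (hpos : ∀ j ≠ i, μ.pos j = μ'.pos j)
    (x : unitInterval) :
    μ.mean x - μ'.mean x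
      = (if μ.pos i ≤ x then μ.jump i else 0) - (if μ'.pos i ≤ x then μ.jump i else 0) := by
  rw [mean, mean, hbase, hjump, add_sub_add_left_eq_sub, ← Finset.sum_sub_distrib]
  refine Finset.sum_eq_single_of_mem i (Finset.mem_univ _) fun j _ hji => ?_
  rw [hpos j hji, sub_self]

theorem isLocalPerturbation_mean {μ μ' : CPEnvironment m} (hbase : μ.baseline = μ'.baseline)
    (hjump : μ.jump = μ'.jump) {i : Fin m} (hpos : ∀ j ≠ i, μ.pos j = μ'.pos j) {a b : ℝ}
    (h : μ.pos i ∈ Set.Icc a b) (h' : μ'.pos i ∈ Set.Icc a b) :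
    IsLocalPerturbation μ.mean μ'.mean (window a b) (μ.jump i) where
  measurable_left := μ.measurable_mean
  measurable_right := μ'.measurable_mean
  measurableSet := measurableSet_window a b
  eq_off x hx := by
    rw [← sub_eq_zero, mean_sub_mean hbase hjump hpos]
    obtain hxa | hbx : (x : ℝ) < a ∨ b ≤ x := by
      simpa [window, or_iff_not_imp_left] using hx
    · rw [if_neg (hxa.trans_le h.1).not_ge, if_neg (hxa.trans_le h'.1).not_ge, sub_self]
    · rw [if_pos (h.2.trans hbx), if_pos (h'.2.trans hbx), sub_self]
  sq_sub_le x := by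
    rw [mean_sub_mean hbase hjump hpos]
    split_ifs <;> simp [sq_nonneg]

variable (ν : CPEnvironment m)

theorem spacing_succ {i : ℕ} (h : i + 1 < m) :
    ν.spacing (i + 1) = ν.pos ⟨i + 1, h⟩ - ν.pos ⟨i, Nat.lt_of_succ_lt h⟩ := by
  rw [spacing, dif_pos ⟨Nat.le_add_left 1 i, h⟩]
  rfl

theorem spacing_succ_le {i j : Fin m} (h : i < j) : ν.spacing (i + 1) ≤ ν.pos j - ν.pos i := by
  rw [ν.spacing_succ (by omega)]
  exact sub_le_sub_right (ν.pos_strictMono.monotone (Fin.mk_le_of_le_val h)) _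

theorem spacing_le {i j : Fin m} (h : i < j) : ν.spacing j ≤ ν.pos j - ν.pos i := by
  obtain ⟨k, hk⟩ : ∃ k : ℕ, (j : ℕ) = k + 1 := ⟨j - 1, by omega⟩
  have hj : j = ⟨k + 1, hk ▸ j.2⟩ := Fin.ext hk
  rw [hk, ν.spacing_succ (hk ▸ j.2), ← hj]
  exact sub_le_sub_left (ν.pos_strictMono.monotone (Fin.le_def.2 (by simp only; omega))) _

theorem spacing_pos (i : ℕ) : 0 < ν.spacing i := by
  unfold spacing
  split_ifs with h
  · exact sub_pos.2 (ν.pos_strictMono (Fin.mk_lt_mk.2 (by omega)))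
  · exact one_pos

theorem spacing_le_one (i : ℕ) : ν.spacing i ≤ 1 := by
  unfold spacing
  split_ifs with h
  · linarith [(ν.pos_mem ⟨i, h.2⟩).2, (ν.pos_mem ⟨i - 1, by omega⟩).1]
  · exact le_rfl

theorem localSpacing_pos (i : Fin m) : 0 < ν.localSpacing i :=
  lt_min (ν.spacing_pos _) (ν.spacing_pos _)

theorem localSpacing_le_one (i : Fin m) : ν.localSpacing i ≤ 1 :=
  (min_le_left _ _).trans (ν.spacing_le_one _)

theorem localSpacing_left_le_sub {i j : Fin m} (h : i < j) :
    ν.localSpacing i ≤ ν.pos j - ν.pos i :=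
  (min_le_right _ _).trans (ν.spacing_succ_le h)

theorem localSpacing_right_le_sub {i j : Fin m} (h : i < j) :
    ν.localSpacing j ≤ ν.pos j - ν.pos i :=
  (min_le_left _ _).trans (ν.spacing_le h)

theorem localSpacing_le_abs {i j : Fin m} (h : j ≠ i) :
    ν.localSpacing i ≤ |ν.pos i - ν.pos j| := by
  obtain h | h := lt_or_gt_of_ne h
  · exact (ν.localSpacing_right_le_sub h).trans (le_abs_self _)
  · rw [abs_sub_comm]
    exact (ν.localSpacing_left_le_sub h).trans (le_abs_self _)

theorem exists_abs_eq_localSpacing {i : Fin m} (h : ν.localSpacing i < 1) :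
    ∃ j ≠ i, |ν.pos i - ν.pos j| = ν.localSpacing i := by
  obtain hmin | hmin := min_choice (ν.spacing i) (ν.spacing (i + 1))
  all_goals
    rw [localSpacing, hmin, spacing] at h ⊢
    split_ifs at h ⊢ with hi
    swap; · exact absurd h (lt_irrefl 1)
  · have hlt : (⟨i - 1, by omega⟩ : Fin m) < i := Fin.mk_lt_of_lt_val (by omega)
    exact ⟨_, hlt.ne, abs_of_pos (sub_pos.2 (ν.pos_strictMono hlt))⟩
  · have hlt : i < (⟨i + 1, hi.2⟩ : Fin m) := Fin.lt_def.2 (Nat.lt_succ_self i)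
    refine ⟨_, hlt.ne', ?_⟩
    rw [abs_sub_comm]
    exact abs_of_pos (sub_pos.2 (ν.pos_strictMono hlt))

theorem le_localSpacing_iff {i : Fin m} {r : ℝ} :
    r ≤ ν.localSpacing i ↔ r ≤ 1 ∧ ∀ j ≠ i, r ≤ |ν.pos i - ν.pos j| := by
  refine ⟨fun h => ⟨h.trans (ν.localSpacing_le_one i),
    fun j hj => h.trans (ν.localSpacing_le_abs hj)⟩, fun ⟨hone, habs⟩ => ?_⟩
  obtain h | h := lt_or_ge (ν.localSpacing i) 1
  · obtain ⟨j, hj, hij⟩ := ν.exists_abs_eq_localSpacing h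
    exact hij ▸ habs j hj
  · exact hone.trans h

theorem jump_sq_pos (i : Fin m) : 0 < ν.jump i ^ 2 := sq_pos_of_ne_zero (ν.jump_ne_zero i)

theorem jump_sq_le_one (i : Fin m) : ν.jump i ^ 2 ≤ 1 :=
  (sq_le_one_iff_abs_le_one _).2 (ν.abs_jump_le_one i)

theorem energySq_pos (i : Fin m) : 0 < ν.energySq i :=
  mul_pos (ν.localSpacing_pos i) (ν.jump_sq_pos i)

theorem one_div_energySq_le (i : Fin m) : 1 / ν.energySq i ≤ ν.detectComplexity :=
  le_ciSup (f := fun i => 1 / ν.energySq i) (Set.finite_range _).bddAbove i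

theorem detectComplexity_nonneg : 0 ≤ ν.detectComplexity :=
  Real.iSup_nonneg fun i => (one_div_pos.2 (ν.energySq_pos i)).le

theorem localizeComplexity_nonneg : 0 ≤ ν.localizeComplexity m := by
  rw [localizeComplexity_self]
  positivity

/-- The complexities of `ν'` agree with those of `ν` up to the factors that the lower bound
allows. -/
structure Comparable (ν ν' : CPEnvironment m) : Prop where
  detect_le : ν.detectComplexity ≤ ν'.detectComplexity
  le_detect : ν'.detectComplexity ≤ 4 * ν.detectComplexity
  le_localize : 1 / 2 * ν.localizeComplexity m ≤ ν'.localizeComplexity m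
  localize_le : ν'.localizeComplexity m ≤ ν.localizeComplexity m

variable {ν} {ν' : CPEnvironment m}

theorem Comparable.of_perm (σ : Equiv.Perm (Fin m)) (hjump : ∀ i, ν'.jump i = ν.jump (σ i))
    (hle : ∀ i, 1 / 4 * ν.localSpacing (σ i) ≤ ν'.localSpacing i)
    (hge : ∀ i, ν'.localSpacing i ≤ ν.localSpacing (σ i)) : ν.Comparable ν' := by
  have hlocalize : ν'.localizeComplexity m = ν.localizeComplexity m := by
    simp_rw [localizeComplexity_self, hjump]
    exact Equiv.sum_comp σ fun i => 1 / ν.jump i ^ 2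
  refine ⟨?_, ?_, by linarith [ν.localizeComplexity_nonneg], hlocalize.le⟩
  · refine Real.iSup_le (fun i => ?_) ν'.detectComplexity_nonneg
    obtain ⟨i, rfl⟩ := σ.surjective i
    refine le_trans ?_ (ν'.one_div_energySq_le i)
    refine one_div_le_one_div_of_le (ν'.energySq_pos i) ?_
    rw [energySq, energySq, hjump]
    gcongr
    exact hge i
  · refine Real.iSup_le (fun i => ?_) (mul_nonneg zero_le_four ν.detectComplexity_nonneg)
    calc 1 / ν'.energySq i ≤ 1 / (1 / 4 * ν.energySq (σ i)) := by
          refine one_div_le_one_div_of_le (by linarith [ν.energySq_pos (σ i)]) ?_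
          rw [energySq, energySq, hjump, ← mul_assoc]
          gcongr
          exact hle i
      _ = 4 * (1 / ν.energySq (σ i)) := by ring
      _ ≤ 4 * ν.detectComplexity := by gcongr; exact ν.one_div_energySq_le _

theorem Comparable.of_distances (hjump : ν'.jump = ν.jump)
    (hle : ∀ i j, i < j → 1 / 4 * (ν.pos j - ν.pos i) ≤ ν'.pos j - ν'.pos i)
    (hge : ∀ i j, i < j → ν'.pos j - ν'.pos i ≤ ν.pos j - ν.pos i) : ν.Comparable ν' := by
  have habs (μ : CPEnvironment m) {i j : Fin m} (h : i < j) :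
      |μ.pos j - μ.pos i| = μ.pos j - μ.pos i := abs_of_pos (sub_pos.2 (μ.pos_strictMono h))
  have hdist {i j : Fin m} (hij : i ≠ j) : 1 / 4 * |ν.pos i - ν.pos j| ≤ |ν'.pos i - ν'.pos j|
      ∧ |ν'.pos i - ν'.pos j| ≤ |ν.pos i - ν.pos j| := by
    obtain h | h := lt_or_gt_of_ne hij
    · rw [abs_sub_comm, abs_sub_comm (ν'.pos i), habs _ h, habs _ h]
      exact ⟨hle i j h, hge i j h⟩
    · rw [habs _ h, habs _ h]
      exact ⟨hle j i h, hge j i h⟩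
  refine .of_perm (Equiv.refl _) (congrFun hjump) (fun i => ?_) (fun i => ?_) <;>
    rw [Equiv.refl_apply]
  · refine ν'.le_localSpacing_iff.2 ⟨?_, fun j hj => le_trans ?_ (hdist hj.symm).1⟩
    · linarith [ν.localSpacing_pos i, ν.localSpacing_le_one i]
    · gcongr
      exact ν.localSpacing_le_abs hj
  · exact ν.le_localSpacing_iff.2 ⟨ν'.localSpacing_le_one i,
      fun j hj => (ν'.localSpacing_le_abs hj).trans (hdist hj.symm).2⟩

end CPEnvironment

namespace CPAlgorithm

variable {N m : ℕ} (π : CPAlgorithm N)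

theorem law_eq_gaussianLaw {ν : CPEnvironment m} (hν : ν.noise = gaussianReal 0 1) :
    π.law ν = π.gaussianLaw := by
  rw [law, gaussianLaw, hν]

theorem budget_eq_duration (ν : CPEnvironment m) (ω : π.Outcome) :
    π.budget ν ω = π.duration (π.play ν.mean ω) := by
  simp_rw [budget, duration, trunc_play, history_eq_trajectory]

theorem expectedBudget_eq {ν : CPEnvironment m} (hν : ν.noise = gaussianReal 0 1) :
    π.expectedBudget ν = ∫⁻ ω, (π.duration ω : ℝ≥0∞) ∂π.traceLaw ν.mean := by
  simp_rw [expectedBudget, traceLaw, π.law_eq_gaussianLaw hν, budget_eq_duration, ← visits_univ]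
  rw [lintegral_map (π.measurable_visits .univ) (π.measurable_play ν.measurable_mean)]

theorem sum_lintegral_visits_le {ν : CPEnvironment m} (hν : ν.noise = gaussianReal 0 1)
    {ι : Type*} (S : Finset ι) {J : ι → Set unitInterval} (hJ : ∀ i, MeasurableSet (J i))
    (hdisj : (S : Set ι).PairwiseDisjoint J) :
    ∑ i ∈ S, ∫⁻ ω, π.visits (J i) ω ∂π.traceLaw ν.mean ≤ π.expectedBudget ν := by
  rw [π.expectedBudget_eq hν, ← lintegral_finsetSum _ fun i _ => π.measurable_visits (hJ i)]
  exact lintegral_mono fun ω => π.sum_visits_le S hdisj ω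

theorem measurable_estimate_past (n : ℕ) (l : Fin N) :
    Measurable[π.past n] fun ω => π.estimate n (π.trunc n ω) l :=
  (measurable_pi_apply l).comp ((π.measurable_estimate n).comp (π.measurable_trunc_past le_rfl))

/-- The outcomes for which the estimates available after `n` observations are within `η` of
`p`. -/
def accurate (p : Fin N → ℝ) (η : ℝ) (n : ℕ) : Set π.Outcome :=
  ⋂ l, {ω | |π.estimate n (π.trunc n ω) l - p l| ≤ η}

theorem measurableSet_accurate (p : Fin N → ℝ) (η : ℝ) (n : ℕ) :
    MeasurableSet[π.past n] (π.accurate p η n) :=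
  .iInter fun l => measurableSet_le
    ((continuous_abs.measurable.comp (measurable_sub_const (p l))).comp
      (π.measurable_estimate_past n l)) measurable_const

theorem disjoint_haltsIn_accurate {p q : Fin N → ℝ} {η : ℝ} {l : Fin N} (h : 2 * η < |q l - p l|) :
    Disjoint (π.haltsIn (π.accurate p η)) (π.haltsIn (π.accurate q η)) := by
  refine π.disjoint_haltsIn fun n => Set.disjoint_left.2 fun ω hp hq => ?_
  have hpl := (Set.mem_iInter.1 hp l).out
  have hql := (Set.mem_iInter.1 hq l).out
  rw [abs_sub_comm] at hql
  linarith [abs_sub_le (q l) (π.estimate n (π.trunc n ω) l) (p l)]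

variable {π : CPAlgorithm m} {δ η : ℝ}

theorem IsCorrect.le_traceLaw_haltsIn_accurate (hπ : π.IsCorrect δ η) {ν : CPEnvironment m}
    (hν : ν.noise = gaussianReal 0 1) :
    1 - δ ≤ (π.traceLaw ν.mean).real (π.haltsIn (π.accurate ν.pos η)) := by
  have hlaw := hπ m le_rfl ν
  have hplay := π.measurable_play ν.measurable_mean
  rw [π.law_eq_gaussianLaw hν] at hlaw
  refine (ENNReal.ofReal_le_iff_le_toReal (measure_ne_top _ _)).1 ?_
  rw [traceLaw, Measure.map_apply hplay (π.measurableSet_haltsIn fun n =>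
    π.measurableSet_accurate ν.pos η n)]
  refine hlaw.trans (measure_mono fun ω hω => ?_)
  obtain ⟨n, hn, i, hi, hest⟩ := hω.out
  have hid : hi.orderIsoOfSurjective i (Finite.surjective_of_injective hi.injective)
      = OrderIso.refl _ := Subsingleton.elim _ _
  refine mem_haltsIn.2 ⟨n, by rw [← budget_eq_duration, hn], Set.mem_iInter.2 fun l => ?_⟩
  have hl : i l = l := congrArg (fun e : Fin m ≃o Fin m => e l) hid
  simpa only [Set.mem_ofPred_eq, trunc_play, history_eq_trajectory, hl] using hest l

theorem IsCorrect.traceLaw_haltsIn_accurate_le (hπ : π.IsCorrect δ η) {ν : CPEnvironment m}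
    (hν : ν.noise = gaussianReal 0 1) {p : Fin m → ℝ} {l : Fin m}
    (h : 2 * η < |ν.pos l - p l|) :
    (π.traceLaw ν.mean).real (π.haltsIn (π.accurate p η)) ≤ δ := by
  have hunion := measureReal_union (μ := π.traceLaw ν.mean) (π.disjoint_haltsIn_accurate h)
    (π.measurableSet_haltsIn fun n => π.measurableSet_accurate ν.pos η n)
  linarith [hπ.le_traceLaw_haltsIn_accurate hν, measureReal_le_one (μ := π.traceLaw ν.mean)
    (s := π.haltsIn (π.accurate p η) ∪ π.haltsIn (π.accurate ν.pos η))]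

theorem IsCorrect.lintegral_visits_ge (hπ : π.IsCorrect δ η) (hδ : δ ∈ Set.Ioo (0 : ℝ) (1 / 16))
    {μ μ' : CPEnvironment m} (hμ : μ.noise = gaussianReal 0 1) (hμ' : μ'.noise = gaussianReal 0 1)
    {J : Set unitInterval} {d : ℝ} (h : IsLocalPerturbation μ.mean μ'.mean J d) {l : Fin m}
    (hl : 2 * η < |μ'.pos l - μ.pos l|) :
    ENNReal.ofReal (7 / 16 * (1 / d ^ 2 * Real.log (1 / (4 * δ))))
      ≤ ∫⁻ ω, π.visits J ω ∂π.traceLaw μ.mean :=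
  π.lintegral_visits_ge_of_haltsIn h (fun n => π.measurableSet_accurate μ.pos η n) hδ.1 hδ.2
    (hπ.le_traceLaw_haltsIn_accurate hμ) (hπ.traceLaw_haltsIn_accurate_le hμ' hl)

end CPAlgorithm

theorem strictMono_update {ι α : Type*} [Preorder ι] [DecidableEq ι] [Preorder α] {p : ι → α}
    (hp : StrictMono p) {i : ι} {z : α} (hlt : ∀ j < i, p j < z) (hgt : ∀ j > i, z < p j) :
    StrictMono (Function.update p i z) := by
  intro a b hab
  obtain rfl | ha := eq_or_ne a i
  · rw [Function.update_self, Function.update_of_ne hab.ne']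
    exact hgt b hab
  · rw [Function.update_of_ne ha]
    obtain rfl | hb := eq_or_ne b i
    · rw [Function.update_self]
      exact hlt a hab
    · rw [Function.update_of_ne hb]
      exact hp hab

/-- The `i`-th of the change points `p` can be moved to `z` without leaving `(0, 1)` or meeting
another change point. -/
structure CanMove {m : ℕ} (p : Fin m → ℝ) (i : Fin m) (z : ℝ) : Prop where
  mem_Ioo : z ∈ Set.Ioo (0 : ℝ) 1
  gt_of_lt : ∀ j < i, p j < z
  lt_of_gt : ∀ j > i, z < p j

/-- The `i`-th of the change points `p` can be moved by more than `r`. -/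
def HasRoom {m : ℕ} (p : Fin m → ℝ) (r : ℝ) (i : Fin m) : Prop :=
  ∃ z, CanMove p i z ∧ r < |z - p i|

namespace CPEnvironment

variable {m : ℕ} (ν : CPEnvironment m)

/-- The environment in which the `i`-th change point has been moved to `z`. -/
noncomputable def move {i : Fin m} {z : ℝ} (h : CanMove ν.pos i z) : CPEnvironment m :=
  { ν with
    pos := Function.update ν.pos i z
    pos_strictMono := strictMono_update ν.pos_strictMono h.gt_of_lt h.lt_of_gt
    pos_mem := (Function.forall_update_iff _ fun _ x => x ∈ Set.Ioo (0 : ℝ) 1).2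
      ⟨h.mem_Ioo, fun j _ => ν.pos_mem j⟩ }

theorem move_pos {i : Fin m} {z : ℝ} (h : CanMove ν.pos i z) : (ν.move h).pos i = z :=
  Function.update_self _ _ _

theorem isLocalPerturbation_move {i : Fin m} {z : ℝ} (h : CanMove ν.pos i z) :
    IsLocalPerturbation ν.mean (ν.move h).mean
      (window (min (ν.pos i) z) (max (ν.pos i) z)) (ν.jump i) := by
  have hpos (j : Fin m) (hj : j ≠ i) : ν.pos j = (ν.move h).pos j :=
    (Function.update_of_ne hj _ _).symm
  refine isLocalPerturbation_mean (μ := ν) (μ' := ν.move h) rfl rfl hpos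
    ⟨min_le_left _ _, le_max_left _ _⟩ ?_
  rw [move_pos]
  exact ⟨min_le_right _ _, le_max_right _ _⟩

theorem hasRoom_of_lt_spacing_succ {i : Fin m} (hi : (i : ℕ) + 1 < m) {r : ℝ} (hr : 0 < r)
    (h : r < ν.spacing (i + 1)) : HasRoom ν.pos r i := by
  have hle {j : Fin m} (hj : i < j) := ν.spacing_succ_le hj
  have hlt : i < (⟨i + 1, hi⟩ : Fin m) := Fin.lt_def.2 (Nat.lt_succ_self i)
  refine ⟨ν.pos i + (r + ν.spacing (i + 1)) / 2, ⟨⟨?_, ?_⟩, fun j hj => ?_, fun j hj => ?_⟩, ?_⟩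
  · linarith [(ν.pos_mem i).1]
  · linarith [hle hlt, (ν.pos_mem ⟨i + 1, hi⟩).2]
  · linarith [ν.pos_strictMono hj]
  · linarith [hle hj]
  · rw [add_sub_cancel_left]
    exact lt_of_lt_of_le (by linarith) (le_abs_self _)

theorem hasRoom_of_lt_spacing {i : Fin m} (hi : 0 < (i : ℕ)) {r : ℝ} (hr : 0 < r)
    (h : r < ν.spacing i) : HasRoom ν.pos r i := by
  have hle {j : Fin m} (hj : j < i) := ν.spacing_le hj
  have hlt : (⟨0, by omega⟩ : Fin m) < i := Fin.lt_def.2 hi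
  refine ⟨ν.pos i - (r + ν.spacing i) / 2, ⟨⟨?_, ?_⟩, fun j hj => ?_, fun j hj => ?_⟩, ?_⟩
  · linarith [hle hlt, (ν.pos_mem ⟨0, by omega⟩).1]
  · linarith [(ν.pos_mem i).2]
  · linarith [hle hj]
  · linarith [ν.pos_strictMono hj]
  · rw [sub_sub_cancel_left, abs_neg]
    exact lt_of_lt_of_le (by linarith) (le_abs_self _)

theorem hasRoom_of_forall_lt_spacing {r : ℝ} (hr : 0 < r)
    (hspacing : ∀ k : ℕ, 2 ≤ k → k ≤ m - 1 → r < ν.spacing k) (hm : 3 ≤ m) {i : Fin m}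
    (hi : 0 < (i : ℕ)) : HasRoom ν.pos r i := by
  obtain hlast | hlast := lt_or_ge ((i : ℕ) + 1) m
  · exact ν.hasRoom_of_lt_spacing_succ hlast hr (hspacing _ (by omega) (by omega))
  · exact ν.hasRoom_of_lt_spacing hi hr (hspacing _ (by omega) (by omega))

/-- The copy of an environment whose noise is standard Gaussian and whose jumps are permuted. -/
noncomputable def permuted (σ : Equiv.Perm (Fin m)) : CPEnvironment m :=
  gaussian ν.pos (ν.jump ∘ σ) ν.pos_strictMono ν.pos_mem (fun i => ν.jump_ne_zero (σ i))
    (fun i => ν.abs_jump_le_one (σ i))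

theorem comparable_permuted {σ : Equiv.Perm (Fin m)}
    (h : ∀ i, ν.localSpacing (σ i) = ν.localSpacing i) : ν.Comparable (ν.permuted σ) := by
  have hle (i : Fin m) : (ν.permuted σ).localSpacing i = ν.localSpacing (σ i) := (h i).symm
  refine .of_perm σ (fun i => rfl) (fun i => ?_) (fun i => (hle i).le)
  rw [hle]
  linarith [ν.localSpacing_pos (σ i)]

theorem localSpacing_swap {i₀ i₁ : Fin m} (h₀ : (i₀ : ℕ) = 0) (h₁ : (i₁ : ℕ) = 1)
    (h : ν.spacing 1 ≤ ν.spacing 2) (i : Fin m) :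
    ν.localSpacing (Equiv.swap i₀ i₁ i) = ν.localSpacing i := by
  have hspacing : ν.spacing 0 = 1 := dif_neg (by omega)
  have hzero : ν.localSpacing i₀ = ν.spacing 1 := by
    rw [localSpacing, h₀, hspacing]
    exact min_eq_right (ν.spacing_le_one 1)
  have hone : ν.localSpacing i₁ = ν.spacing 1 := by
    rw [localSpacing, h₁]
    exact min_eq_left h
  rw [Equiv.swap_apply_def]
  split_ifs with hi hi
  · rw [hi, hone, hzero]
  · rw [hi, hone, hzero]
  · rfl

/-- The Gaussian copy of an environment whose change points are squeezed into the middle of the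
unit interval. -/
noncomputable def centered : CPEnvironment m :=
  gaussian (fun i => 3 / 8 + ν.pos i / 4) ν.jump
    (fun i j h => by dsimp only; linarith [ν.pos_strictMono h])
    (fun i => ⟨by linarith [(ν.pos_mem i).1], by linarith [(ν.pos_mem i).2]⟩)
    ν.jump_ne_zero ν.abs_jump_le_one

theorem comparable_centered : ν.Comparable ν.centered := by
  refine .of_distances rfl (fun i j h => ?_) (fun i j h => ?_) <;>
  · have := ν.pos_strictMono h
    simp only [centered, gaussian]
    linarith

theorem hasRoom_centered (hm : m ≤ 2) {r : ℝ} (hr : r < 1 / 4) (i : Fin m) :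
    HasRoom ν.centered.pos r i := by
  have hi := ν.pos_mem i
  obtain hfirst | hfirst := Nat.eq_zero_or_pos (i : ℕ)
  · refine ⟨1 / 16, ⟨by norm_num, fun _ _ => by omega, fun j _ => ?_⟩, ?_⟩
    all_goals simp only [centered, gaussian]
    · linarith [(ν.pos_mem j).1]
    · exact lt_of_lt_of_le (by linarith [hi.1]) (neg_le_abs _)
  · refine ⟨15 / 16, ⟨by norm_num, fun j _ => ?_, fun _ _ => by omega⟩, ?_⟩
    all_goals simp only [centered, gaussian]
    · linarith [(ν.pos_mem j).2]
    · exact lt_of_lt_of_le (by linarith [hi.2]) (le_abs_self _)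

end CPEnvironment

theorem ofReal_half_add_le {x y : ℝ} {E : ℝ≥0∞} (hx : ENNReal.ofReal x ≤ E)
    (hy : ENNReal.ofReal y ≤ E) : ENNReal.ofReal ((x + y) / 2) ≤ E := by
  refine le_trans ?_ (max_le hx hy)
  rw [← ENNReal.ofReal_max]
  exact ENNReal.ofReal_le_ofReal (by linarith [le_max_left x y, le_max_right x y])

namespace CPAlgorithm

variable {m : ℕ} {π : CPAlgorithm m} {δ η : ℝ}

theorem IsCorrect.expectedBudget_ge_of_canMove (hπ : π.IsCorrect δ η)
    (hδ : δ ∈ Set.Ioo (0 : ℝ) (1 / 16)) {μ : CPEnvironment m} (hμ : μ.noise = gaussianReal 0 1)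
    (S : Finset (Fin m)) {z : Fin m → ℝ} (hz : ∀ i ∈ S, CanMove μ.pos i (z i))
    (hfar : ∀ i ∈ S, 2 * η < |z i - μ.pos i|)
    (hsep : ∀ i ∈ S, ∀ j ∈ S, i < j → max (μ.pos i) (z i) ≤ min (μ.pos j) (z j)) :
    ENNReal.ofReal (7 / 16 * ((∑ i ∈ S, 1 / μ.jump i ^ 2) * Real.log (1 / (4 * δ))))
      ≤ π.expectedBudget μ := by
  have hlog : 0 ≤ Real.log (1 / (4 * δ)) :=
    Real.log_nonneg ((one_le_div (by linarith [hδ.1])).2 (by linarith [hδ.2]))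
  rw [Finset.sum_mul, Finset.mul_sum, ENNReal.ofReal_sum_of_nonneg fun i _ => by positivity]
  refine le_trans (Finset.sum_le_sum fun i hi => ?_) (π.sum_lintegral_visits_le hμ S
    (J := fun i => window (min (μ.pos i) (z i)) (max (μ.pos i) (z i)))
    (fun i => measurableSet_window _ _) fun i hi j hj hij => ?_)
  · refine hπ.lintegral_visits_ge hδ hμ (μ' := μ.move (hz i hi)) hμ
      (μ.isLocalPerturbation_move (hz i hi)) (l := i) ?_
    rw [μ.move_pos]
    exact hfar i hi
  · obtain h | h := lt_or_gt_of_ne hij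
    · exact disjoint_window (hsep i hi j hj h)
    · exact (disjoint_window (hsep j hj i hi h)).symm

/-- Only moves in the same direction are sure to affect disjoint windows, hence the loss of a
factor two. -/
theorem IsCorrect.expectedBudget_ge_of_hasRoom (hπ : π.IsCorrect δ η)
    (hδ : δ ∈ Set.Ioo (0 : ℝ) (1 / 16)) {μ : CPEnvironment m} (hμ : μ.noise = gaussianReal 0 1)
    (S : Finset (Fin m)) (hroom : ∀ i ∈ S, HasRoom μ.pos (2 * η) i) :
    ENNReal.ofReal (7 / 32 * ((∑ i ∈ S, 1 / μ.jump i ^ 2) * Real.log (1 / (4 * δ))))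
      ≤ π.expectedBudget μ := by
  choose! z hz hfar using hroom
  have hright := hπ.expectedBudget_ge_of_canMove hδ hμ (S.filter fun i => μ.pos i ≤ z i)
    (fun i hi => hz i (Finset.mem_filter.1 hi).1) (fun i hi => hfar i (Finset.mem_filter.1 hi).1)
    fun i hi j hj hij => by
      rw [Finset.mem_filter] at hi hj
      rw [max_eq_right hi.2, min_eq_left hj.2]
      exact ((hz i hi.1).lt_of_gt j hij).le
  have hleft := hπ.expectedBudget_ge_of_canMove hδ hμ (S.filter fun i => ¬ μ.pos i ≤ z i)
    (fun i hi => hz i (Finset.mem_filter.1 hi).1) (fun i hi => hfar i (Finset.mem_filter.1 hi).1)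
    fun i hi j hj hij => by
      rw [Finset.mem_filter, not_le] at hi hj
      rw [max_eq_left hi.2.le, min_eq_right hj.2.le]
      exact ((hz j hj.1).gt_of_lt i hij).le
  refine le_trans (le_of_eq ?_) (ofReal_half_add_le hright hleft)
  rw [← Finset.sum_filter_add_sum_filter_not S fun i => μ.pos i ≤ z i]
  congr 1
  ring

theorem IsCorrect.exists_expectedBudget_ge_localize_of_le_two (hπ : π.IsCorrect δ η)
    (hδ : δ ∈ Set.Ioo (0 : ℝ) (1 / 16)) (hη : η < 1 / 8) (hm : m ≤ 2) (ν : CPEnvironment m) :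
    ∃ ν' : CPEnvironment m, ν.Comparable ν' ∧
      ENNReal.ofReal (7 / 32 * (ν.localizeComplexity m * Real.log (1 / (4 * δ))))
        ≤ π.expectedBudget ν' := by
  refine ⟨ν.centered, ν.comparable_centered, ?_⟩
  rw [CPEnvironment.localizeComplexity_self]
  exact hπ.expectedBudget_ge_of_hasRoom hδ rfl Finset.univ fun i _ =>
    ν.hasRoom_centered hm (by linarith) i

theorem IsCorrect.expectedBudget_permuted_ge (hπ : π.IsCorrect δ η)
    (hδ : δ ∈ Set.Ioo (0 : ℝ) (1 / 16)) (ν : CPEnvironment m) (σ : Equiv.Perm (Fin m))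
    (S : Finset (Fin m)) (hroom : ∀ i ∈ S, HasRoom ν.pos (2 * η) i) :
    ENNReal.ofReal (7 / 32 * ((∑ i ∈ S, 1 / ν.jump (σ i) ^ 2) * Real.log (1 / (4 * δ))))
      ≤ π.expectedBudget (ν.permuted σ) :=
  hπ.expectedBudget_ge_of_hasRoom hδ (μ := ν.permuted σ) rfl S hroom

theorem IsCorrect.exists_expectedBudget_ge_localize_of_hasRoom (hπ : π.IsCorrect δ η)
    (hδ : δ ∈ Set.Ioo (0 : ℝ) (1 / 16)) (ν : CPEnvironment m)
    (hroom : ∀ i, HasRoom ν.pos (2 * η) i) :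
    ∃ ν' : CPEnvironment m, ν.Comparable ν' ∧
      ENNReal.ofReal (7 / 32 * (ν.localizeComplexity m * Real.log (1 / (4 * δ))))
        ≤ π.expectedBudget ν' := by
  refine ⟨ν.permuted 1, ν.comparable_permuted fun i => rfl, ?_⟩
  rw [CPEnvironment.localizeComplexity_self]
  exact hπ.expectedBudget_permuted_ge hδ ν 1 Finset.univ fun i _ => hroom i

/-- The first change point may be stuck between its neighbour and the origin. Exchanging the two
leftmost jumps then lets its neighbour play its role. -/
theorem IsCorrect.exists_expectedBudget_ge_localize_of_swap (hπ : π.IsCorrect δ η)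
    (hδ : δ ∈ Set.Ioo (0 : ℝ) (1 / 16)) (hm : 2 ≤ m) (ν : CPEnvironment m)
    (hroom : ∀ i : Fin m, 0 < (i : ℕ) → HasRoom ν.pos (2 * η) i)
    (hν : ν.spacing 1 ≤ ν.spacing 2) :
    ∃ ν' : CPEnvironment m, ν.Comparable ν' ∧
      ENNReal.ofReal (7 / 64 * (ν.localizeComplexity m * Real.log (1 / (4 * δ))))
        ≤ π.expectedBudget ν' := by
  let i₀ : Fin m := ⟨0, by omega⟩
  let i₁ : Fin m := ⟨1, by omega⟩
  let σ := Equiv.swap i₀ i₁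
  have hlog : 0 ≤ Real.log (1 / (4 * δ)) :=
    Real.log_nonneg ((one_le_div (by linarith [hδ.1])).2 (by linarith [hδ.2]))
  have hbound (τ : Equiv.Perm (Fin m)) := hπ.expectedBudget_permuted_ge hδ ν τ
    (Finset.univ.erase i₀) fun i hi => hroom i <|
      Nat.pos_of_ne_zero (Fin.val_ne_iff.2 (Finset.ne_of_mem_erase hi))
  have hsum : ν.localizeComplexity m ≤ ∑ i ∈ Finset.univ.erase i₀, 1 / ν.jump (σ i) ^ 2
      + ∑ i ∈ Finset.univ.erase i₀, 1 / ν.jump i ^ 2 := by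
    have hsingle := Finset.single_le_sum (f := fun i => 1 / ν.jump (σ i) ^ 2)
      (fun i _ => by positivity)
      (Finset.mem_erase.2 ⟨(by simp [i₀, i₁] : i₁ ≠ i₀), Finset.mem_univ i₁⟩)
    rw [CPEnvironment.localizeComplexity_self,
      ← Finset.add_sum_erase _ (fun i => 1 / ν.jump i ^ 2) (Finset.mem_univ i₀)]
    simp only [σ, Equiv.swap_apply_right] at hsingle ⊢
    gcongr
  obtain hle | hle := le_total (∑ i ∈ Finset.univ.erase i₀, 1 / ν.jump i ^ 2)
    (∑ i ∈ Finset.univ.erase i₀, 1 / ν.jump (σ i) ^ 2)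
  · refine ⟨_, ν.comparable_permuted (ν.localSpacing_swap rfl rfl hν),
      le_trans (ENNReal.ofReal_le_ofReal ?_) (hbound σ)⟩
    nlinarith
  · refine ⟨_, ν.comparable_permuted fun i => rfl,
      le_trans (ENNReal.ofReal_le_ofReal ?_) (hbound 1)⟩
    simp only [Equiv.Perm.one_apply]
    nlinarith

theorem IsCorrect.exists_expectedBudget_ge_localize (hπ : π.IsCorrect δ η)
    (hδ : δ ∈ Set.Ioo (0 : ℝ) (1 / 16)) (hη : η ∈ Set.Ioo (0 : ℝ) (1 / 8)) (ν : CPEnvironment m)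
    (hν : ∀ i : ℕ, 2 ≤ i → i ≤ m - 1 → 2 * η < ν.spacing i) :
    ∃ ν' : CPEnvironment m, ν.Comparable ν' ∧
      ENNReal.ofReal (7 / 64 * (ν.localizeComplexity m * Real.log (1 / (4 * δ))))
        ≤ π.expectedBudget ν' := by
  have hη₀ : 0 < 2 * η := by linarith [hη.1]
  have hlog : 0 ≤ Real.log (1 / (4 * δ)) :=
    Real.log_nonneg ((one_le_div (by linarith [hδ.1])).2 (by linarith [hδ.2]))
  have hweaken : 7 / 64 * (ν.localizeComplexity m * Real.log (1 / (4 * δ)))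
      ≤ 7 / 32 * (ν.localizeComplexity m * Real.log (1 / (4 * δ))) := by
    linarith [mul_nonneg ν.localizeComplexity_nonneg hlog]
  obtain hm | hm : m ≤ 2 ∨ 3 ≤ m := by omega
  · obtain ⟨ν', hcomp, h⟩ := hπ.exists_expectedBudget_ge_localize_of_le_two hδ hη.2 hm ν
    exact ⟨ν', hcomp, (ENNReal.ofReal_le_ofReal hweaken).trans h⟩
  have hroom (i : Fin m) (hi : 0 < (i : ℕ)) : HasRoom ν.pos (2 * η) i :=
    ν.hasRoom_of_forall_lt_spacing hη₀ hν hm hi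
  obtain hfirst | hfirst := lt_or_ge (2 * η) (ν.spacing 1)
  · obtain ⟨ν', hcomp, h⟩ := hπ.exists_expectedBudget_ge_localize_of_hasRoom hδ ν fun i => by
      obtain hi | hi := Nat.eq_zero_or_pos (i : ℕ)
      · exact ν.hasRoom_of_lt_spacing_succ (by omega) hη₀ (by rwa [hi])
      · exact hroom i hi
    exact ⟨ν', hcomp, (ENNReal.ofReal_le_ofReal hweaken).trans h⟩
  · exact hπ.exists_expectedBudget_ge_localize_of_swap hδ (by omega) ν hroom
      (hfirst.trans (hν 2 le_rfl (by omega)).le)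

end CPAlgorithm

theorem exists_separated_offsets {w η : ℝ} (hw : 0 < w) (hη : 0 < η) :
    ∃ (K : ℕ) (o : Fin K → ℝ), 0 < K ∧ w / (2 * η) ≤ K ∧ (∀ k, |o k| ≤ w) ∧
      Pairwise fun k k' => 2 * η < |o k' - o k| := by
  set K := ⌈w / (2 * η)⌉₊
  have hK : 0 < K := Nat.ceil_pos.2 (by positivity)
  have hK' : (0 : ℝ) < K := Nat.cast_pos.2 hK
  refine ⟨K, fun k => k * (2 * w / K) - w, hK, Nat.le_ceil _, fun k => ?_, fun k k' hkk' => ?_⟩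
  · have hle : (k : ℝ) * (2 * w / K) ≤ 2 * w := by
      calc (k : ℝ) * (2 * w / K) ≤ K * (2 * w / K) := by gcongr; exact k.2.le
        _ = 2 * w := mul_div_cancel₀ _ hK'.ne'
    have hnonneg : 0 ≤ (k : ℝ) * (2 * w / K) := by positivity
    exact abs_le.2 ⟨by linarith, by linarith⟩
  · have hone : 1 < w / (2 * η) := by
      by_contra! hle
      have : K ≤ 1 := Nat.ceil_le.2 (by simpa using hle)
      exact hkk' (Fin.ext (by omega))
    have hstep : 2 * η < 2 * w / K := by
      have hlt : K < 2 * (w / (2 * η)) := by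
        linarith [Nat.ceil_lt_add_one (a := w / (2 * η)) (by positivity)]
      rw [lt_div_iff₀ hK']
      calc 2 * η * K < 2 * η * (2 * (w / (2 * η))) := by gcongr
        _ = 2 * w := by field_simp
    have hdist : (1 : ℝ) ≤ |((k' : ℕ) : ℝ) - ((k : ℕ) : ℝ)| := by
      have hne : ((k' : ℕ) : ℤ) - ((k : ℕ) : ℤ) ≠ 0 := fun h => hkk' (Fin.ext (by omega))
      have hone := Int.one_le_abs hne
      rify at hone
      exact hone
    beta_reduce
    rw [sub_sub_sub_cancel_right, ← sub_mul, abs_mul, abs_of_pos (hstep.trans' (by positivity))]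
    nlinarith

theorem sum_sum_update {ι M : Type*} [Fintype ι] [DecidableEq ι] {β : ι → Type*}
    [∀ i, Fintype (β i)] [AddCommMonoid M] (F : (∀ i, β i) → M) (i : ι) :
    ∑ κ, ∑ k, F (Function.update κ i k) = Fintype.card (β i) • ∑ κ, F κ := by
  have hswap : Function.Involutive
      fun p : (∀ j, β j) × β i => (Function.update p.1 i p.2, p.1 i) := fun p => by simp
  calc ∑ κ, ∑ k, F (Function.update κ i k)
      = ∑ p : (∀ j, β j) × β i, F (Function.update p.1 i p.2) :=
        (Fintype.sum_prod_type' fun κ k => F (Function.update κ i k)).symm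
    _ = ∑ p : (∀ j, β j) × β i, F p.1 := Equiv.sum_comp (hswap.toPerm _) fun p => F p.1
    _ = Fintype.card (β i) • ∑ κ, F κ := by
        rw [Fintype.sum_prod_type, Finset.smul_sum]
        simp only [Finset.sum_const, Finset.card_univ]

theorem exists_sum_le_of_coordinate_averages {ι : Type*} [Fintype ι] [DecidableEq ι]
    {β : ι → Type*} [∀ i, Fintype (β i)] [∀ i, Nonempty (β i)] (F : ι → (∀ i, β i) → ℝ≥0∞)
    (b : ι → ℝ≥0∞)
    (h : ∀ i κ, Fintype.card (β i) * b i ≤ ∑ k, F i (Function.update κ i k)) :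
    ∃ κ, ∑ i, b i ≤ ∑ i, F i κ := by
  have havg (i : ι) : ∑ _κ : (∀ i, β i), b i ≤ ∑ κ, F i κ := by
    refine (ENNReal.mul_le_mul_iff_right (Nat.cast_ne_zero.2 Fintype.card_ne_zero)
      (ENNReal.natCast_ne_top (Fintype.card (β i)))).1 ?_
    rw [← nsmul_eq_mul _ (∑ κ, F i κ), ← sum_sum_update, Finset.mul_sum]
    exact Finset.sum_le_sum fun κ _ => h i κ
  by_contra! hlt
  have hsum := ENNReal.sum_lt_sum_of_nonempty Finset.univ_nonempty fun κ _ => hlt κ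
  rw [Finset.sum_comm, Finset.sum_comm (f := fun _ i => b i)] at hsum
  exact hsum.not_ge (Finset.sum_le_sum fun i _ => havg i)

namespace CPEnvironment

variable {m : ℕ} (ν : CPEnvironment m)

theorem jitter_distance_bounds {o : Fin m → ℝ} (ho : ∀ i, |o i| ≤ ν.localSpacing i / 8)
    {i j : Fin m} (h : i < j) :
    1 / 4 * (ν.pos j - ν.pos i) ≤ 1 / 4 + ν.pos j / 2 + o j - (1 / 4 + ν.pos i / 2 + o i) ∧
      1 / 4 + ν.pos j / 2 + o j - (1 / 4 + ν.pos i / 2 + o i) ≤ ν.pos j - ν.pos i := by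
  have hi := abs_le.1 (ho i)
  have hj := abs_le.1 (ho j)
  have hi' := ν.localSpacing_left_le_sub h
  have hj' := ν.localSpacing_right_le_sub h
  have hlt := ν.pos_strictMono h
  exact ⟨by linarith, by linarith⟩

/-- The Gaussian environment obtained by squeezing the change points into the middle half of the
unit interval and displacing them by a fraction of their local spacings. -/
noncomputable def jitter (o : Fin m → ℝ) (ho : ∀ i, |o i| ≤ ν.localSpacing i / 8) :
    CPEnvironment m :=
  gaussian (fun i => 1 / 4 + ν.pos i / 2 + o i) ν.jump
    (fun i j h => by linarith [(ν.jitter_distance_bounds ho h).1, ν.pos_strictMono h])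
    (fun i => by
      have hi := abs_le.1 (ho i)
      have hpos := ν.pos_mem i
      have hone := ν.localSpacing_le_one i
      exact ⟨by linarith [hpos.1], by linarith [hpos.2]⟩)
    ν.jump_ne_zero ν.abs_jump_le_one

theorem comparable_jitter {o : Fin m → ℝ} (ho : ∀ i, |o i| ≤ ν.localSpacing i / 8) :
    ν.Comparable (ν.jitter o ho) :=
  .of_distances rfl (fun _ _ h => (ν.jitter_distance_bounds ho h).1)
    fun _ _ h => (ν.jitter_distance_bounds ho h).2

/-- The window within which `jitter` displaces a change point. -/
def jitterWindow (i : Fin m) : Set unitInterval :=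
  window (1 / 4 + ν.pos i / 2 - ν.localSpacing i / 8) (1 / 4 + ν.pos i / 2 + ν.localSpacing i / 8)

theorem pairwise_disjoint_jitterWindow : Pairwise (Function.onFun Disjoint ν.jitterWindow) := by
  have hlt {i j : Fin m} (h : i < j) : Disjoint (ν.jitterWindow i) (ν.jitterWindow j) :=
    disjoint_window (by
      linarith [ν.localSpacing_left_le_sub h, ν.localSpacing_right_le_sub h, ν.pos_strictMono h])
  intro i j hij
  obtain h | h := lt_or_gt_of_ne hij
  · exact hlt h
  · exact (hlt h).symm

theorem isLocalPerturbation_jitter {o o' : Fin m → ℝ} (ho : ∀ i, |o i| ≤ ν.localSpacing i / 8)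
    (ho' : ∀ i, |o' i| ≤ ν.localSpacing i / 8) {i : Fin m} (h : ∀ j ≠ i, o j = o' j) :
    IsLocalPerturbation (ν.jitter o ho).mean (ν.jitter o' ho').mean (ν.jitterWindow i)
      (ν.jump i) := by
  have hmem {o : Fin m → ℝ} (ho : ∀ i, |o i| ≤ ν.localSpacing i / 8) :
      (ν.jitter o ho).pos i ∈ Set.Icc (1 / 4 + ν.pos i / 2 - ν.localSpacing i / 8)
        (1 / 4 + ν.pos i / 2 + ν.localSpacing i / 8) :=
    ⟨by simp only [jitter, gaussian]; linarith [(abs_le.1 (ho i)).1],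
      by simp only [jitter, gaussian]; linarith [(abs_le.1 (ho i)).2]⟩
  refine isLocalPerturbation_mean (μ := ν.jitter o ho) (μ' := ν.jitter o' ho') rfl rfl
    (fun j hj => ?_) (hmem ho) (hmem ho')
  simp only [jitter, gaussian, h j hj]

end CPEnvironment

namespace CPAlgorithm

variable {m : ℕ} {π : CPAlgorithm m} {δ η : ℝ}

theorem IsCorrect.sum_lintegral_visits_jitter_ge (hπ : π.IsCorrect δ η) (hδ : δ < 1 / 16)
    (ν : CPEnvironment m) {ι : Type*} [Fintype ι] {o : ι → Fin m → ℝ} {o' : Fin m → ℝ}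
    (ho : ∀ k i, |o k i| ≤ ν.localSpacing i / 8) (ho' : ∀ i, |o' i| ≤ ν.localSpacing i / 8)
    {i : Fin m} (hoff : ∀ k, ∀ j ≠ i, o k j = o' j)
    (hsep : Pairwise fun k k' => 2 * η < |o k' i - o k i|) :
    ENNReal.ofReal (Fintype.card ι
        * (7 / 16 * (1 / ν.jump i ^ 2 * Real.posLog (Fintype.card ι / 4))))
      ≤ ∑ k, ∫⁻ ω, π.visits (ν.jitterWindow i) ω ∂π.traceLaw (ν.jitter (o k) (ho k)).mean := by
  refine π.sum_lintegral_visits_ge_of_disjoint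
    (fun k => ν.isLocalPerturbation_jitter (ho k) ho' (hoff k))
    (fun k n => π.measurableSet_accurate (ν.jitter (o k) (ho k)).pos η n)
    (fun k k' hkk' => π.disjoint_haltsIn_accurate (l := i) ?_)
    fun k => by linarith [hπ.le_traceLaw_haltsIn_accurate (ν := ν.jitter (o k) (ho k)) rfl]
  simpa only [CPEnvironment.jitter, CPEnvironment.gaussian, add_sub_add_left_eq_sub]
    using hsep hkk'

theorem IsCorrect.exists_expectedBudget_ge_posLog (hπ : π.IsCorrect δ η) (hδ : δ < 1 / 16)
    (hη : 0 < η) (ν : CPEnvironment m) :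
    ∃ ν' : CPEnvironment m, ν.Comparable ν' ∧
      ENNReal.ofReal
          (7 / 16 * ∑ i, 1 / ν.jump i ^ 2 * Real.posLog (ν.localSpacing i / (64 * η)))
        ≤ π.expectedBudget ν' := by
  choose K o hK hle ho hsep using fun i =>
    exists_separated_offsets (w := ν.localSpacing i / 8) (by linarith [ν.localSpacing_pos i]) hη
  have (i : Fin m) : Nonempty (Fin (K i)) := Fin.pos_iff_nonempty.1 (hK i)
  let μ (κ : ∀ i, Fin (K i)) := ν.jitter (fun i => o i (κ i)) fun i => ho i (κ i)
  obtain ⟨κ, hκ⟩ := exists_sum_le_of_coordinate_averages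
    (fun i κ => ∫⁻ ω, π.visits (ν.jitterWindow i) ω ∂π.traceLaw (μ κ).mean)
    (fun i => ENNReal.ofReal (7 / 16 * (1 / ν.jump i ^ 2 * Real.posLog (K i / 4))))
    fun i κ => by
      have h := hπ.sum_lintegral_visits_jitter_ge hδ ν
        (o := fun k j => o j (Function.update κ i k j)) (fun k j => ho j _) (fun j => ho j (κ j))
        (i := i) (fun k j hj => by rw [Function.update_of_ne hj])
        (by simpa only [Function.update_self] using hsep i)
      rw [ENNReal.ofReal_mul (Nat.cast_nonneg _), ENNReal.ofReal_natCast, Fintype.card_fin] at h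
      rwa [Fintype.card_fin]
  refine ⟨μ κ, ν.comparable_jitter _, le_trans ?_ (hκ.trans (π.sum_lintegral_visits_le (ν := μ κ)
    rfl Finset.univ (fun i => measurableSet_window _ _)
    (ν.pairwise_disjoint_jitterWindow.set_pairwise _)))⟩
  rw [Finset.mul_sum, ← ENNReal.ofReal_sum_of_nonneg fun i _ =>
    mul_nonneg (by norm_num) (mul_nonneg (by positivity) Real.posLog_nonneg)]
  refine ENNReal.ofReal_le_ofReal (Finset.sum_le_sum fun i _ => ?_)
  have hnonneg : 0 ≤ ν.localSpacing i / (64 * η) :=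
    div_nonneg (ν.localSpacing_pos i).le (by linarith)
  have hcard : ν.localSpacing i / (64 * η) ≤ K i / 4 := by
    calc ν.localSpacing i / (64 * η) = ν.localSpacing i / 8 / (2 * η) / 4 := by
          rw [div_div, div_div]
          ring_nf
      _ ≤ K i / 4 := div_le_div_of_nonneg_right (hle i) zero_le_four
  gcongr

end CPAlgorithm

theorem CPEnvironment.sum_posLog_le {m : ℕ} (ν : CPEnvironment m) (η : ℝ) :
    ∑ i, 1 / ν.jump i ^ 2 * Real.posLog (ν.localSpacing i / (16 * η))
      ≤ ∑ i, 1 / ν.jump i ^ 2 * Real.posLog (ν.localSpacing i / (64 * η))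
        + ν.localizeComplexity m * Real.log 4 := by
  have hfour : Real.posLog 4 = Real.log 4 := Real.posLog_eq_log (by norm_num)
  rw [localizeComplexity_self, Finset.sum_mul, ← Finset.sum_add_distrib]
  refine Finset.sum_le_sum fun i _ => ?_
  have hsplit : ν.localSpacing i / (16 * η) = ν.localSpacing i / (64 * η) * 4 := by
    rw [div_mul, mul_div_right_comm]
    norm_num
  rw [← mul_add, ← hfour, hsplit]
  gcongr
  exact Real.posLog_mul

theorem strictMono_cons {α : Type*} [Preorder α] {n : ℕ} {a : α} {f : Fin n → α}
    (ha : ∀ i, a < f i) (hf : StrictMono f) :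
    StrictMono (Fin.cons a f : Fin (n + 1) → α) := by
  intro i j hij
  obtain ⟨j, rfl⟩ := Fin.exists_succ_eq.2 (Fin.ne_zero_of_lt hij)
  cases i using Fin.cases with
  | zero => exact ha j
  | succ i => exact hf (Fin.succ_lt_succ_iff.1 hij)

theorem pairwise_disjoint_window_add_mul (a s : ℝ) :
    Pairwise (Function.onFun Disjoint fun k : ℕ => window (a + k * s) (a + k * s + s)) := by
  intro k k' hkk'
  have h := Set.pairwise_disjoint_Ico_add_zsmul a s (Nat.cast_injective.ne hkk' : (k : ℤ) ≠ k')
  simp only [Function.onFun, add_smul, one_smul, natCast_zsmul, nsmul_eq_mul, ← add_assoc] at h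
  exact h.preimage _

theorem exists_natCast_mul_le_sixteenth {s : ℝ} (hs : 0 < s) (hs' : s ≤ 1 / 32) :
    ∃ K : ℕ, K * s ≤ 1 / 16 ∧ 1 / (32 * s) ≤ K := by
  refine ⟨⌊1 / (16 * s)⌋₊, ?_, ?_⟩
  · rw [← le_div_iff₀ hs, div_div]
    exact Nat.floor_le (by positivity)
  · have htwo : 2 ≤ 1 / (16 * s) := by
      rw [le_div_iff₀ (by positivity)]
      linarith
    have hhalf : 1 / (32 * s) = 1 / (16 * s) / 2 := by ring
    linarith [Nat.lt_floor_add_one (1 / (16 * s))]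

namespace CPEnvironment

theorem one_div_jump_sq_ge_one {m : ℕ} (ν : CPEnvironment m) (i : Fin m) :
    1 ≤ 1 / ν.jump i ^ 2 :=
  (one_le_div (ν.jump_sq_pos i)).2 (ν.jump_sq_le_one i)

theorem detectComplexity_le_localizeComplexity_of_le_one {m : ℕ} (ν : CPEnvironment m)
    (hm : m ≤ 1) : ν.detectComplexity ≤ ν.localizeComplexity m := by
  refine Real.iSup_le (fun i => ?_) ν.localizeComplexity_nonneg
  have hone : ν.localSpacing i = 1 := (ν.localSpacing_le_one i).antisymm
    (ν.le_localSpacing_iff.2 ⟨le_rfl, fun j hj => absurd (Fin.ext (by omega)) hj⟩)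
  rw [energySq, hone, one_mul, localizeComplexity_self]
  exact Finset.single_le_sum (f := fun i => 1 / ν.jump i ^ 2) (fun i _ => by positivity)
    (Finset.mem_univ i)

variable {q : ℕ} (ν : CPEnvironment (q + 2)) {x s d : ℝ}

/-- The environment obtained by deleting the first two change points and squeezing the others into
the last quarter of the unit interval. It is the reference in which bumps are hidden. -/
noncomputable def background : CPEnvironment q :=
  gaussian (fun l => 3 / 4 + ν.pos l.succ.succ / 4) (fun l => ν.jump l.succ.succ)
    (fun l l' h => by
      linarith [ν.pos_strictMono (Fin.succ_lt_succ_iff.2 (Fin.succ_lt_succ_iff.2 h))])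
    (fun l => ⟨by linarith [(ν.pos_mem l.succ.succ).1], by linarith [(ν.pos_mem l.succ.succ).2]⟩)
    (fun l => ν.jump_ne_zero _) fun l => ν.abs_jump_le_one _

theorem lt_background_pos (l : Fin q) : 3 / 4 < ν.background.pos l := by
  simp only [background, gaussian]
  linarith [(ν.pos_mem l.succ.succ).1]

/-- The background with a bump of height `d` added on `[x, x + s)`: the jumps of the first two
change points of `ν` are replaced by `d` and `-d`. -/
noncomputable def bump (hx : 0 < x) (hs : 0 < s) (hxs : x + s ≤ 1 / 2)
    (hd : d ∈ Set.Ioc (0 : ℝ) 1) : CPEnvironment (q + 2) :=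
  gaussian (Fin.cons x (Fin.cons (x + s) ν.background.pos))
    (Fin.cons d (Fin.cons (-d) ν.background.jump))
    (strictMono_cons
      (Fin.forall_fin_succ.2
        ⟨lt_add_of_pos_right x hs, fun l => show x < ν.background.pos l by
          linarith [ν.lt_background_pos l]⟩)
      (strictMono_cons (fun l => by linarith [ν.lt_background_pos l])
        ν.background.pos_strictMono))
    (Fin.forall_fin_succ.2 ⟨⟨hx, show x < 1 by linarith⟩,
      Fin.forall_fin_succ.2 ⟨⟨add_pos hx hs, show x + s < 1 by linarith⟩, ν.background.pos_mem⟩⟩)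
    (Fin.forall_fin_succ.2 ⟨hd.1.ne',
      Fin.forall_fin_succ.2 ⟨neg_ne_zero.2 hd.1.ne', ν.background.jump_ne_zero⟩⟩)
    (Fin.forall_fin_succ.2 ⟨(abs_of_pos hd.1).trans_le hd.2,
      Fin.forall_fin_succ.2 ⟨((abs_neg d).trans (abs_of_pos hd.1)).trans_le hd.2,
        ν.background.abs_jump_le_one⟩⟩)

variable (hx : 0 < x) (hs : 0 < s) (hxs : x + s ≤ 1 / 2) (hd : d ∈ Set.Ioc (0 : ℝ) 1)

theorem mean_bump (t : unitInterval) :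
    (ν.bump hx hs hxs hd).mean t
      = (if x ≤ t then d else 0) + ((if x + s ≤ t then -d else 0) + ν.background.mean t) := by
  rw [mean, Fin.sum_univ_succ, Fin.sum_univ_succ, show ν.background.mean t = 0 + _ from rfl,
    zero_add]
  exact zero_add _

theorem isLocalPerturbation_bump :
    IsLocalPerturbation (ν.bump hx hs hxs hd).mean ν.background.mean (window x (x + s)) d where
  measurable_left := measurable_mean _
  measurable_right := measurable_mean _
  measurableSet := measurableSet_window _ _
  eq_off t ht := by
    rw [mean_bump]
    obtain hlt | hle : (t : ℝ) < x ∨ x + s ≤ t := by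
      simpa [window, or_iff_not_imp_left] using ht
    · rw [if_neg hlt.not_ge, if_neg (by linarith), zero_add, zero_add]
    · rw [if_pos (by linarith), if_pos hle, add_neg_cancel_left]
  sq_sub_le t := by
    rw [mean_bump, ← add_assoc, add_sub_cancel_right]
    split_ifs <;> simp [sq_nonneg]

theorem localSpacing_bump_zero_le : (ν.bump hx hs hxs hd).localSpacing 0 ≤ s :=
  (localSpacing_left_le_sub _ (Fin.succ_pos 0)).trans_eq (add_sub_cancel_left x s)

theorem le_localSpacing_bump_zero :
    s ≤ (ν.bump hx hs hxs hd).localSpacing 0 := by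
  refine (le_localSpacing_iff _).2 ⟨by linarith, Fin.forall_fin_succ.2 ⟨fun h => absurd rfl h,
    Fin.forall_fin_succ.2 ⟨fun _ => ?_, fun l _ => ?_⟩⟩⟩
  · change s ≤ |x - (x + s)|
    exact (neg_le_abs _).trans' (by linarith)
  · change s ≤ |x - ν.background.pos l|
    exact (neg_le_abs _).trans' (by linarith [ν.lt_background_pos l])

theorem le_localSpacing_bump_one (hs' : s ≤ 1 / 4) :
    s ≤ (ν.bump hx hs hxs hd).localSpacing (Fin.succ 0) := by
  refine (le_localSpacing_iff _).2 ⟨by linarith, Fin.forall_fin_succ.2 ⟨fun _ => ?_,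
    Fin.forall_fin_succ.2 ⟨fun h => absurd rfl h, fun l _ => ?_⟩⟩⟩
  · change s ≤ |x + s - x|
    exact (le_abs_self _).trans' (by linarith)
  · change s ≤ |x + s - ν.background.pos l|
    exact (neg_le_abs _).trans' (by linarith [ν.lt_background_pos l])

theorem le_localSpacing_bump_succ_succ (l : Fin q) :
    1 / 4 * ν.localSpacing l.succ.succ ≤ (ν.bump hx hs hxs hd).localSpacing l.succ.succ := by
  have hone := ν.localSpacing_le_one l.succ.succ
  refine (le_localSpacing_iff _).2 ⟨by linarith, Fin.forall_fin_succ.2 ⟨fun _ => ?_,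
    Fin.forall_fin_succ.2 ⟨fun _ => ?_, fun l' hl' => ?_⟩⟩⟩
  · change 1 / 4 * ν.localSpacing l.succ.succ ≤ |ν.background.pos l - x|
    exact (le_abs_self _).trans' (by linarith [ν.lt_background_pos l])
  · change 1 / 4 * ν.localSpacing l.succ.succ ≤ |ν.background.pos l - (x + s)|
    exact (le_abs_self _).trans' (by linarith [ν.lt_background_pos l])
  · change 1 / 4 * ν.localSpacing l.succ.succ
      ≤ |3 / 4 + ν.pos l.succ.succ / 4 - (3 / 4 + ν.pos l'.succ.succ / 4)|
    rw [add_sub_add_left_eq_sub, ← sub_div, abs_div, abs_of_pos (zero_lt_four' ℝ),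
      one_div_mul_eq_div]
    gcongr
    exact ν.localSpacing_le_abs hl'

theorem detectComplexity_bump_le (hs' : s ≤ 1 / 4)
    (hdetect : 1 / (s * d ^ 2) = ν.detectComplexity) :
    (ν.bump hx hs hxs hd).detectComplexity ≤ 4 * ν.detectComplexity := by
  have hnonneg := ν.detectComplexity_nonneg
  have hle {k : Fin (q + 2)} (hspacing : s ≤ (ν.bump hx hs hxs hd).localSpacing k)
      (hjump : (ν.bump hx hs hxs hd).jump k ^ 2 = d ^ 2) :
      1 / (ν.bump hx hs hxs hd).energySq k ≤ 4 * ν.detectComplexity := by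
    calc 1 / (ν.bump hx hs hxs hd).energySq k ≤ 1 / (s * d ^ 2) := by
          rw [energySq, hjump]
          have := hd.1
          gcongr
      _ ≤ 4 * ν.detectComplexity := by linarith
  refine Real.iSup_le (Fin.forall_fin_succ.2 ⟨?_, Fin.forall_fin_succ.2 ⟨?_, fun l => ?_⟩⟩)
    (by linarith)
  · exact hle (ν.le_localSpacing_bump_zero hx hs hxs hd) rfl
  · exact hle (ν.le_localSpacing_bump_one hx hs hxs hd hs') (neg_sq d)
  · calc 1 / (ν.bump hx hs hxs hd).energySq l.succ.succ
          ≤ 1 / (1 / 4 * ν.energySq l.succ.succ) := by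
          refine one_div_le_one_div_of_le (by linarith [ν.energySq_pos l.succ.succ]) ?_
          rw [energySq, energySq, ← mul_assoc]
          exact mul_le_mul_of_nonneg_right (ν.le_localSpacing_bump_succ_succ hx hs hxs hd l)
            (sq_nonneg _)
      _ = 4 * (1 / ν.energySq l.succ.succ) := by ring
      _ ≤ 4 * ν.detectComplexity := by gcongr; exact ν.one_div_energySq_le _

theorem comparable_bump (hs' : s ≤ 1 / 4) (hdetect : 1 / (s * d ^ 2) = ν.detectComplexity)
    (hlocalize : 2 / d ^ 2 = 1 / ν.jump 0 ^ 2 + 1 / ν.jump (Fin.succ 0) ^ 2) :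
    ν.Comparable (ν.bump hx hs hxs hd) := by
  have heq : (ν.bump hx hs hxs hd).localizeComplexity (q + 2) = ν.localizeComplexity (q + 2) := by
    rw [localizeComplexity_self, localizeComplexity_self, Fin.sum_univ_succ, Fin.sum_univ_succ,
      Fin.sum_univ_succ, Fin.sum_univ_succ, ← add_assoc, ← add_assoc, ← hlocalize]
    simp only [bump, background, gaussian, Fin.cons_zero, Fin.cons_succ, neg_sq]
    ring
  refine ⟨?_, ν.detectComplexity_bump_le hx hs hxs hd hs' hdetect,
    by linarith [ν.localizeComplexity_nonneg], heq.le⟩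
  refine le_trans ?_ (one_div_energySq_le _ 0)
  rw [← hdetect]
  exact one_div_le_one_div_of_le (energySq_pos _ 0)
    (mul_le_mul_of_nonneg_right (ν.localSpacing_bump_zero_le hx hs hxs hd) (sq_nonneg d))

end CPEnvironment

namespace CPAlgorithm

variable {m : ℕ} {π : CPAlgorithm m} {δ η : ℝ}

/-- The situations in which the estimate of the `l`-th change point lies within `η` of
`[a, a + 1 / 16]`. -/
def aimsAt (π : CPAlgorithm m) (l : Fin m) (η a : ℝ) (n : ℕ) : Set π.Outcome :=
  {ω | π.estimate n (π.trunc n ω) l ∈ Set.Icc (a - η) (a + 1 / 16 + η)}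

theorem measurableSet_aimsAt (π : CPAlgorithm m) (l : Fin m) (η a : ℝ) (n : ℕ) :
    MeasurableSet[π.past n] (π.aimsAt l η a n) :=
  π.measurable_estimate_past n l measurableSet_Icc

theorem haltsIn_accurate_subset_haltsIn_aimsAt {p : Fin m → ℝ} {l : Fin m} {a : ℝ}
    (h : p l ∈ Set.Icc a (a + 1 / 16)) :
    π.haltsIn (π.accurate p η) ⊆ π.haltsIn (π.aimsAt l η a) := by
  intro ω hω
  obtain ⟨n, hn, hacc⟩ := π.mem_haltsIn.1 hω
  have hl := abs_le.1 (Set.mem_iInter.1 hacc l).out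
  exact π.mem_haltsIn.2 ⟨n, hn, by linarith [h.1], by linarith [h.2]⟩

theorem exists_traceLaw_aimsAt_le_half (π : CPAlgorithm m) (l : Fin m) (hη : η < 1 / 8)
    {h : unitInterval → ℝ} (hh : Measurable h) :
    ∃ a ∈ Set.Ioc (0 : ℝ) (7 / 16), (π.traceLaw h).real (π.haltsIn (π.aimsAt l η a)) ≤ 1 / 2 := by
  have := π.isProbabilityMeasure_traceLaw hh
  have hdisj : Disjoint (π.haltsIn (π.aimsAt l η (1 / 16))) (π.haltsIn (π.aimsAt l η (7 / 16))) :=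
    π.disjoint_haltsIn fun n => Set.disjoint_left.2 fun ω hω hω' => by
      linarith [hω.out.2, hω'.out.1]
  by_contra! hlt
  have hlow := hlt (1 / 16) (by norm_num)
  have hhigh := hlt (7 / 16) (by norm_num)
  have hunion := measureReal_union (μ := π.traceLaw h) hdisj
    (π.measurableSet_haltsIn (π.measurableSet_aimsAt l η (7 / 16)))
  linarith [measureReal_le_one (μ := π.traceLaw h)
    (s := π.haltsIn (π.aimsAt l η (1 / 16)) ∪ π.haltsIn (π.aimsAt l η (7 / 16)))]

theorem IsCorrect.le_traceLaw_bump_aimsAt {q : ℕ} {π : CPAlgorithm (q + 2)}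
    (hπ : π.IsCorrect δ η) (hδ : δ < 1 / 16) (ν : CPEnvironment (q + 2)) {x s d : ℝ}
    (hx : 0 < x) (hs : 0 < s) (hxs : x + s ≤ 1 / 2) (hd : d ∈ Set.Ioc (0 : ℝ) 1) {a : ℝ}
    (hxa : x ∈ Set.Icc a (a + 1 / 16)) :
    15 / 16 ≤ (π.traceLaw (ν.bump hx hs hxs hd).mean).real (π.haltsIn (π.aimsAt 0 η a)) := by
  have := π.isProbabilityMeasure_traceLaw (ν.bump hx hs hxs hd).measurable_mean
  have hsuccess := hπ.le_traceLaw_haltsIn_accurate (ν := ν.bump hx hs hxs hd) rfl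
  have hsub : π.haltsIn (π.accurate (ν.bump hx hs hxs hd).pos η) ⊆ π.haltsIn (π.aimsAt 0 η a) :=
    haltsIn_accurate_subset_haltsIn_aimsAt hxa
  linarith [measureReal_mono (μ := π.traceLaw (ν.bump hx hs hxs hd).mean) hsub]

theorem IsCorrect.exists_expectedBudget_bump_ge {q : ℕ} {π : CPAlgorithm (q + 2)}
    (hπ : π.IsCorrect δ η) (hδ : δ < 1 / 16) (hη : η < 1 / 8) (ν : CPEnvironment (q + 2)) {s d : ℝ}
    (hs : 0 < s) (hs' : s ≤ 1 / 32) (hd : d ∈ Set.Ioc (0 : ℝ) 1) :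
    ∃ (x : ℝ) (hx : 0 < x) (hxs : x + s ≤ 1 / 2),
      ENNReal.ofReal (1 / 2621440 * (1 / (s * d ^ 2)))
        ≤ π.expectedBudget (ν.bump hx hs hxs hd) := by
  obtain ⟨a, ha, hunlikely⟩ :=
    π.exists_traceLaw_aimsAt_le_half 0 hη ν.background.measurable_mean
  obtain ⟨K, hKle, hKge⟩ := exists_natCast_mul_le_sixteenth hs hs'
  have hK : Nonempty (Fin K) := Fin.pos_iff_nonempty.1 <| Nat.cast_pos.1 <|
    (show (0 : ℝ) < 1 / (32 * s) by positivity).trans_le hKge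
  have hstep (k : Fin K) : 0 ≤ k * s ∧ k * s + s ≤ 1 / 16 := by
    have hk : (k : ℝ) + 1 ≤ K := by exact_mod_cast k.2
    exact ⟨by positivity, by nlinarith⟩
  let x (k : Fin K) := a + k * s
  have hx (k : Fin K) : 0 < x k := add_pos_of_pos_of_nonneg ha.1 (hstep k).1
  have hxs (k : Fin K) : x k + s ≤ 1 / 2 := by linarith [(hstep k).2, ha.2]
  have hsuccess (k : Fin K) : 15 / 16
      ≤ (π.traceLaw (ν.bump (hx k) hs (hxs k) hd).mean).real (π.haltsIn (π.aimsAt 0 η a)) :=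
    hπ.le_traceLaw_bump_aimsAt hδ ν (hx k) hs (hxs k) hd
      ⟨by linarith [(hstep k).1], by linarith [(hstep k).2]⟩
  obtain ⟨k, hk⟩ := π.exists_lintegral_duration_ge_of_disjoint
    (fun k => ν.isLocalPerturbation_bump (hx k) hs (hxs k) hd) hd.1.ne' (pow_le_one₀ hd.1.le hd.2)
    ((pairwise_disjoint_window_add_mul a s).comp_of_injective Fin.val_injective)
    (π.measurableSet_aimsAt 0 η a) hunlikely hsuccess
  refine ⟨x k, hx k, hxs k, ?_⟩
  rw [π.expectedBudget_eq (ν := ν.bump (hx k) hs (hxs k) hd) rfl]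
  refine (ENNReal.ofReal_le_ofReal ?_).trans hk
  calc 1 / 2621440 * (1 / (s * d ^ 2)) = 1 / (32 * s) / (81920 * d ^ 2) := by ring
    _ ≤ Fintype.card (Fin K) / (81920 * d ^ 2) := by
      rw [Fintype.card_fin]
      gcongr

theorem IsCorrect.exists_expectedBudget_ge_detect (hπ : π.IsCorrect δ η) (hδ : δ < 1 / 16)
    (hη : η < 1 / 8) (ν : CPEnvironment m)
    (hlarge : 32 * ν.localizeComplexity m < ν.detectComplexity) :
    ∃ ν' : CPEnvironment m, ν.Comparable ν' ∧
      ENNReal.ofReal (1 / 2621440 * ν.detectComplexity) ≤ π.expectedBudget ν' := by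
  have hlocalize := ν.localizeComplexity_nonneg
  obtain ⟨q, rfl⟩ : ∃ q, m = q + 2 := by
    refine ⟨m - 2, ?_⟩
    by_contra hm
    linarith [ν.detectComplexity_le_localizeComplexity_of_le_one (by omega)]
  set w := (1 / ν.jump 0 ^ 2 + 1 / ν.jump (Fin.succ 0) ^ 2) / 2 with hw
  have hone : 1 ≤ w := by
    linarith [ν.one_div_jump_sq_ge_one 0, ν.one_div_jump_sq_ge_one (Fin.succ 0)]
  have hle : w ≤ ν.localizeComplexity (q + 2) := by
    have hrest : 0 ≤ ∑ l : Fin q, 1 / ν.jump l.succ.succ ^ 2 := by positivity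
    rw [ν.localizeComplexity_self, Fin.sum_univ_succ, Fin.sum_univ_succ]
    linarith
  have hd : √(1 / w) ∈ Set.Ioc (0 : ℝ) 1 :=
    ⟨Real.sqrt_pos.2 (by positivity), Real.sqrt_le_one.2 (div_le_one_of_le₀ hone (by positivity))⟩
  have hdsq : √(1 / w) ^ 2 = 1 / w := Real.sq_sqrt (by positivity)
  have hs : 0 < w / ν.detectComplexity := div_pos (by linarith) (by linarith)
  have hs' : w / ν.detectComplexity ≤ 1 / 32 := by
    rw [div_le_iff₀ (by linarith)]
    linarith
  have henergy : 1 / (w / ν.detectComplexity * √(1 / w) ^ 2) = ν.detectComplexity := by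
    rw [hdsq]
    field_simp
  obtain ⟨x, hx, hxs, hE⟩ := hπ.exists_expectedBudget_bump_ge hδ hη ν hs hs' hd
  rw [henergy] at hE
  refine ⟨_, ν.comparable_bump hx hs hxs hd (by linarith) henergy ?_, hE⟩
  rw [hdsq, div_div_eq_mul_div, hw]
  ring

end CPAlgorithm

theorem one_le_log_four : 1 ≤ Real.log 4 := by
  rw [Real.le_log_iff_exp_le (by norm_num)]
  linarith [Real.exp_one_lt_d9]

theorem log_four_le_log_one_div {δ : ℝ} (hδ : δ ∈ Set.Ioo (0 : ℝ) (1 / 16)) :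
    Real.log 4 ≤ Real.log (1 / (4 * δ)) := by
  refine Real.log_le_log (by norm_num) ((le_div_iff₀ (by linarith [hδ.1])).2 ?_)
  linarith [hδ.2]

theorem corollary1 :
    ∃ c : ℝ, 0 < c ∧
      ∀ (δ η : ℝ), δ ∈ Set.Ioo (0 : ℝ) (1 / 16) → η ∈ Set.Ioo (0 : ℝ) (1 / 8) →
      ∀ (m : ℕ), 1 ≤ m →
      ∀ (ν : CPEnvironment m), (∀ i : ℕ, 2 ≤ i → i ≤ m - 1 → 2 * η < ν.spacing i) →
      ∀ (π : CPAlgorithm m), π.IsCorrect δ η →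
      ∃ ν' : CPEnvironment m,
        ν.detectComplexity ≤ ν'.detectComplexity ∧
        ν'.detectComplexity ≤ 4 * ν.detectComplexity ∧
        1 / 2 * ν.localizeComplexity m ≤ ν'.localizeComplexity m ∧
        ν'.localizeComplexity m ≤ ν.localizeComplexity m ∧
        ENNReal.ofReal
            (c * (ν.detectComplexity + ν.localizeComplexity m * Real.log (1 / (4 * δ))
              + ∑ i, 1 / ν.jump i ^ 2 * Real.posLog (ν.localSpacing i / (16 * η))))
          ≤ π.expectedBudget ν' := by
  refine ⟨1 / 2 ^ 26, by norm_num, fun δ η hδ hη m _ ν hν π hπ => ?_⟩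
  set A := ν.detectComplexity
  set H := ν.localizeComplexity m
  set B := H * Real.log (1 / (4 * δ))
  set C := ∑ i, 1 / ν.jump i ^ 2 * Real.posLog (ν.localSpacing i / (16 * η))
  have hlocalize := ν.localizeComplexity_nonneg
  have hlogFour : H * Real.log 4 ≤ B :=
    mul_le_mul_of_nonneg_left (log_four_le_log_one_div hδ) hlocalize
  have hH : H ≤ H * Real.log 4 := le_mul_of_one_le_right hlocalize one_le_log_four
  suffices h : ∃ ν' : CPEnvironment m, ν.Comparable ν' ∧
      ENNReal.ofReal (1 / 2 ^ 26 * (A + B + C)) ≤ π.expectedBudget ν' by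
    obtain ⟨ν', hcomp, hE⟩ := h
    exact ⟨ν', hcomp.detect_le, hcomp.le_detect, hcomp.le_localize, hcomp.localize_le, hE⟩
  by_cases hB : A + B + C ≤ 256 * B
  · obtain ⟨ν', hcomp, hE⟩ := hπ.exists_expectedBudget_ge_localize hδ hη ν hν
    exact ⟨ν', hcomp, (ENNReal.ofReal_le_ofReal (by linarith)).trans hE⟩
  by_cases hA : A + B + C ≤ 4 * A
  · obtain ⟨ν', hcomp, hE⟩ := hπ.exists_expectedBudget_ge_detect hδ.2 hη.2 ν (by linarith)
    exact ⟨ν', hcomp, (ENNReal.ofReal_le_ofReal (by linarith)).trans hE⟩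
  · obtain ⟨ν', hcomp, hE⟩ := hπ.exists_expectedBudget_ge_posLog hδ.2 hη.1 ν
    exact ⟨ν', hcomp, (ENNReal.ofReal_le_ofReal (by linarith [ν.sum_posLog_le η])).trans hE⟩
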